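/- **Proposition 3.1.** Let $n\ge 2$, let $M^n$ be a connected smooth $n$-manifold, let $F:M^n\to\mathbb{R}^{n+1}$ be a non-degenerate smooth hypersurface immersion, and let $\xi$ be its affine normal, that is, the (unique up to sign) smooth transversal vector field $\xi$ along $F$ such that, in the formulas of Gauss and Weingarten $$D_XF_*Y=F_*\nabla_XY+h(X,Y)\,\xi,\qquad D_X\xi=-F_*SX,$$ $D_X\xi$ is tangent to $F$ for every tangent vector $X$ and $|\det(F_*X_1,\dots,F_*X_n,\xi)|=|\det(h(X_i,X_j))|^{1/2}$ for all tangent vectors $X_1,\dots,X_n$ at a point. Here $D$ is the standard flat connection of $\mathbb{R}^{n+1}$, $\nabla$ is the induced affine connection and the semi-Riemannian metric $h$ is the affine metric. Let $C=\nabla h$ be the cubic form, and let $\hat\nabla$ and $\hat R$ be the Levi-Civita connection and the curvature tensor of $h$. Then the following are equivalent: 1. the cubic form is semi-parallel, i.e. $\hat R\cdot C=0$, where $\hat R(X,Y)\cdot C=\hat\nabla_X\hat\nabla_YC-\hat\nabla_Y\hat\nabla_XC-\hat\nabla_{[X,Y]}C$, and $h$ has constant sectional curvature (there is $c\in\mathbb{R}$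 such that every tangent plane on which $h$ is non-degenerate has sectional curvature $c$); 2. either $F(M^n)$ is contained in a non-degenerate hyperquadric $\{y\in\mathbb{R}^{n+1}: y^{\mathsf T}Ay+2b^{\mathsf T}y+d=0\}$, where $A$ is symmetric and $\begin{pmatrix}A&b\\ b^{\mathsf T}&d\end{pmatrix}$ is nonsingular, or $h$ is flat, i.e. $\hat R=0$. -/

import Mathlib

open scoped Manifold ContDiff Matrix

noncomputable section

namespace AffineHypersurface

/-! Equiaffine geometry of hypersurfaces of `ℝ^(n+1) = (Fin (n + 1) → ℝ)`, whose flat connection `D`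
is the ordinary derivative and whose parallel volume form is the determinant.
Tensor fields are written in components with respect to the coordinate fields `∂_i` of a chart.
In the first section `f` is a local parametrization of a hypersurface and `ξ` is a vector field
along it, both as functions of the coordinates `x`. -/

section Local

variable {n : ℕ}

/-- The partial derivative `∂_i g` at `x`. -/
def pd {V : Type*} [NormedAddCommGroup V] [NormedSpace ℝ V] (i : Fin n)
    (g : EuclideanSpace ℝ (Fin n) → V) (x : EuclideanSpace ℝ (Fin n)) : V :=
  fderiv ℝ g x (EuclideanSpace.single i (1 : ℝ))

/-- The square matrix with columns `∂_1 f, …, ∂_n f, ξ` at `x`. -/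
def frame (f ξ : EuclideanSpace ℝ (Fin n) → Fin (n + 1) → ℝ) (x : EuclideanSpace ℝ (Fin n)) :
    Matrix (Fin (n + 1)) (Fin (n + 1)) ℝ :=
  Matrix.of fun r c =>
    (Fin.snoc (α := fun _ => Fin (n + 1) → ℝ) (fun i : Fin n => pd i f x) (ξ x) c) r

/-- The symmetric matrix `L_ij = det (∂_1 f, …, ∂_n f, ∂_i ∂_j f)`: up to a nonzero factor, it is
the second fundamental form relative to any transversal vector field. -/
def secondFundamentalMatrix (f : EuclideanSpace ℝ (Fin n) → Fin (n + 1) → ℝ)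
    (x : EuclideanSpace ℝ (Fin n)) : Matrix (Fin n) (Fin n) ℝ :=
  Matrix.of fun i j => (frame f (pd i (pd j f)) x).det

/-- The coordinates of `∂_i ∂_j f` in the basis `∂_1 f, …, ∂_n f, ξ` of `ℝ^(n+1)`. -/
def gaussCoeff (f ξ : EuclideanSpace ℝ (Fin n) → Fin (n + 1) → ℝ) (i j : Fin n)
    (x : EuclideanSpace ℝ (Fin n)) : Fin (n + 1) → ℝ :=
  (frame f ξ x)⁻¹ *ᵥ pd i (pd j f) x

/-- The form `h` of the Gauss formula `∂_i ∂_j f = ∑ k, Γ_ij^k ∂_k f + h_ij ξ`. For the affine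
normal `ξ` it is the affine metric. -/
def metric (f ξ : EuclideanSpace ℝ (Fin n) → Fin (n + 1) → ℝ) (x : EuclideanSpace ℝ (Fin n)) :
    Matrix (Fin n) (Fin n) ℝ :=
  Matrix.of fun i j => gaussCoeff f ξ i j x (Fin.last n)

/-- The coefficients `Γ_ij^k` of the induced connection `∇` of the Gauss formula
`∂_i ∂_j f = ∑ k, Γ_ij^k ∂_k f + h_ij ξ`. -/
def affineChristoffel (f ξ : EuclideanSpace ℝ (Fin n) → Fin (n + 1) → ℝ) (i j k : Fin n)
    (x : EuclideanSpace ℝ (Fin n)) : ℝ :=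
  gaussCoeff f ξ i j x k.castSucc

/-- The cubic form `C = ∇ h`, `C_ijk = ∂_i h_jk - ∑ l, (Γ_ij^l h_lk + Γ_ik^l h_jl)`. -/
def cubicForm (f ξ : EuclideanSpace ℝ (Fin n) → Fin (n + 1) → ℝ) (i j k : Fin n)
    (x : EuclideanSpace ℝ (Fin n)) : ℝ :=
  pd i (fun y => metric f ξ y j k) x
    - ∑ l, affineChristoffel f ξ i j l x * metric f ξ x l k
    - ∑ l, affineChristoffel f ξ i k l x * metric f ξ x j l

/-- The Christoffel symbols of the Levi-Civita connection `∇̂` of `h`,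
`∑ l, h^kl (∂_i h_jl + ∂_j h_il - ∂_l h_ij) / 2`. -/
def leviCivita (f ξ : EuclideanSpace ℝ (Fin n) → Fin (n + 1) → ℝ) (i j k : Fin n)
    (x : EuclideanSpace ℝ (Fin n)) : ℝ :=
  (1 / 2) * ∑ l, (metric f ξ x)⁻¹ k l *
    (pd i (fun y => metric f ξ y j l) x + pd j (fun y => metric f ξ y i l) x
      - pd l (fun y => metric f ξ y i j) x)

/-- The curvature tensor of `∇̂`: `R̂(∂_i, ∂_j) ∂_k = ∑ l, (curvature f ξ i j k l) ∂_l`, where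
`R̂(X, Y) Z = ∇̂_X ∇̂_Y Z - ∇̂_Y ∇̂_X Z - ∇̂_[X, Y] Z`. -/
def curvature (f ξ : EuclideanSpace ℝ (Fin n) → Fin (n + 1) → ℝ) (i j k l : Fin n)
    (x : EuclideanSpace ℝ (Fin n)) : ℝ :=
  pd i (leviCivita f ξ j k l) x - pd j (leviCivita f ξ i k l) x
    + ∑ m, (leviCivita f ξ j k m x * leviCivita f ξ i m l x
      - leviCivita f ξ i k m x * leviCivita f ξ j m l x)

/-- The covariant derivative `∇̂_(∂_i) T` of a `(0,3)`-tensor field `T`. -/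
def covDeriv (f ξ : EuclideanSpace ℝ (Fin n) → Fin (n + 1) → ℝ) (i : Fin n)
    (T : Fin n → Fin n → Fin n → EuclideanSpace ℝ (Fin n) → ℝ) (a b c : Fin n)
    (x : EuclideanSpace ℝ (Fin n)) : ℝ :=
  pd i (T a b c) x
    - ∑ l, leviCivita f ξ i a l x * T l b c x
    - ∑ l, leviCivita f ξ i b l x * T a l c x
    - ∑ l, leviCivita f ξ i c l x * T a b l x

/-- The tensor `R̂ · C`, where `R̂(X, Y) · C = ∇̂_X ∇̂_Y C - ∇̂_Y ∇̂_X C - ∇̂_[X, Y] C`. Here `X = ∂_i`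
and `Y = ∂_j`, so that `[X, Y] = 0`. -/
def curvatureDotCubic (f ξ : EuclideanSpace ℝ (Fin n) → Fin (n + 1) → ℝ) (i j a b c : Fin n)
    (x : EuclideanSpace ℝ (Fin n)) : ℝ :=
  covDeriv f ξ i (covDeriv f ξ j (cubicForm f ξ)) a b c x
    - covDeriv f ξ j (covDeriv f ξ i (cubicForm f ξ)) a b c x

/-- `h(u, v)` for tangent vectors with components `u` and `v`. -/
def metricApply (f ξ : EuclideanSpace ℝ (Fin n) → Fin (n + 1) → ℝ)
    (x : EuclideanSpace ℝ (Fin n)) (u v : Fin n → ℝ) : ℝ :=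
  u ⬝ᵥ metric f ξ x *ᵥ v

/-- The components of `R̂(u, v) w`. -/
def curvatureApply (f ξ : EuclideanSpace ℝ (Fin n) → Fin (n + 1) → ℝ)
    (x : EuclideanSpace ℝ (Fin n)) (u v w : Fin n → ℝ) : Fin n → ℝ :=
  fun l => ∑ i, ∑ j, ∑ k, u i * v j * w k * curvature f ξ i j k l x

/-- `h(u, u) h(v, v) - h(u, v)²`, which is nonzero if and only if `u` and `v` span a plane on which
`h` is non-degenerate. -/
def areaForm (f ξ : EuclideanSpace ℝ (Fin n) → Fin (n + 1) → ℝ)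
    (x : EuclideanSpace ℝ (Fin n)) (u v : Fin n → ℝ) : ℝ :=
  metricApply f ξ x u u * metricApply f ξ x v v - metricApply f ξ x u v ^ 2

/-- The sectional curvature of the plane spanned by `u` and `v`, if `h` is non-degenerate on it. -/
def sectionalCurvature (f ξ : EuclideanSpace ℝ (Fin n) → Fin (n + 1) → ℝ)
    (x : EuclideanSpace ℝ (Fin n)) (u v : Fin n → ℝ) : ℝ :=
  metricApply f ξ x (curvatureApply f ξ x u v v) u / areaForm f ξ x u v

end Local

section Global

variable {n : ℕ} {M : Type*} [TopologicalSpace M] [ChartedSpace (EuclideanSpace ℝ (Fin n)) M]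

/-- `F` is a smooth immersion of `M` in `ℝ^(n+1)` whose second fundamental form is non-degenerate
at every point. -/
structure IsNondegenerateImmersion (F : M → Fin (n + 1) → ℝ) : Prop where
  smooth : ContMDiff (𝓡 n) 𝓘(ℝ, Fin (n + 1) → ℝ) ∞ F
  immersion : ∀ e ∈ atlas (EuclideanSpace ℝ (Fin n)) M, ∀ x ∈ e.target,
    LinearIndependent ℝ fun i : Fin n => pd i (F ∘ e.symm) x
  nondegenerate : ∀ e ∈ atlas (EuclideanSpace ℝ (Fin n)) M, ∀ x ∈ e.target,
    (secondFundamentalMatrix (F ∘ e.symm) x).det ≠ 0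

/-- `ξ` is an affine normal of the non-degenerate immersion `F` (which determines it up to sign):
a smooth transversal vector field along `F` such that `D_X ξ` is tangent to `F` for all tangent
vectors `X` (the Weingarten formula `D_X ξ = - F_* S X`) and such that the induced volume form
`(X_1, …, X_n) ↦ det (F_* X_1, …, F_* X_n, ξ)` is, up to sign, the volume form of the affine
metric `h`. -/
structure IsAffineNormal (F ξ : M → Fin (n + 1) → ℝ) : Prop where
  smooth : ContMDiff (𝓡 n) 𝓘(ℝ, Fin (n + 1) → ℝ) ∞ ξ
  transversal : ∀ e ∈ atlas (EuclideanSpace ℝ (Fin n)) M, ∀ x ∈ e.target,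
    ξ (e.symm x) ∉ Submodule.span ℝ (Set.range fun k : Fin n => pd k (F ∘ e.symm) x)
  tangent : ∀ e ∈ atlas (EuclideanSpace ℝ (Fin n)) M, ∀ x ∈ e.target, ∀ i : Fin n,
    pd i (ξ ∘ e.symm) x ∈ Submodule.span ℝ (Set.range fun k : Fin n => pd k (F ∘ e.symm) x)
  volume : ∀ e ∈ atlas (EuclideanSpace ℝ (Fin n)) M, ∀ x ∈ e.target,
    |(frame (F ∘ e.symm) (ξ ∘ e.symm) x).det| =
      Real.sqrt |(metric (F ∘ e.symm) (ξ ∘ e.symm) x).det|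

/-- The cubic form is semi-parallel: `R̂ · C = 0`. -/
def HasSemiParallelCubicForm (F ξ : M → Fin (n + 1) → ℝ) : Prop :=
  ∀ e ∈ atlas (EuclideanSpace ℝ (Fin n)) M, ∀ x ∈ e.target, ∀ i j a b c : Fin n,
    curvatureDotCubic (F ∘ e.symm) (ξ ∘ e.symm) i j a b c x = 0

/-- The affine metric has constant sectional curvature: all tangent planes of `M` on which it is
non-degenerate have the same sectional curvature. -/
def HasConstantSectionalCurvature (F ξ : M → Fin (n + 1) → ℝ) : Prop :=
  ∃ κ : ℝ, ∀ e ∈ atlas (EuclideanSpace ℝ (Fin n)) M, ∀ x ∈ e.target, ∀ u v : Fin n → ℝ,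
    areaForm (F ∘ e.symm) (ξ ∘ e.symm) x u v ≠ 0 →
      sectionalCurvature (F ∘ e.symm) (ξ ∘ e.symm) x u v = κ

/-- The affine metric is flat: `R̂ = 0`. -/
def HasFlatAffineMetric (F ξ : M → Fin (n + 1) → ℝ) : Prop :=
  ∀ e ∈ atlas (EuclideanSpace ℝ (Fin n)) M, ∀ x ∈ e.target, ∀ i j k l : Fin n,
    curvature (F ∘ e.symm) (ξ ∘ e.symm) i j k l x = 0

end Global

/-- `Q ⊆ ℝ^m` is a non-degenerate hyperquadric: `Q = {y | yᵀ A y + 2 bᵀ y + d = 0}` with `A`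
symmetric and the extended matrix `(A, b; bᵀ, d)` nonsingular (so cones, cylinders and hyperplanes
are excluded; ellipsoids, hyperboloids, elliptic and hyperbolic paraboloids remain). -/
def IsNondegenerateHyperquadric {m : ℕ} (Q : Set (Fin m → ℝ)) : Prop :=
  ∃ (A : Matrix (Fin m) (Fin m) ℝ) (b : Fin m → ℝ) (d : ℝ), A.IsSymm ∧
    (Matrix.fromBlocks A (Matrix.replicateCol Unit b) (Matrix.replicateRow Unit b)
      (Matrix.of fun _ _ : Unit => d)).det ≠ 0 ∧
    Q = {y | y ⬝ᵥ A *ᵥ y + 2 * (b ⬝ᵥ y) + d = 0}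

/-- The hypersurface `F` is (an open part of) a non-degenerate hyperquadric. -/
def IsHyperquadric {n : ℕ} {M : Type*} (F : M → Fin (n + 1) → ℝ) : Prop :=
  ∃ Q : Set (Fin (n + 1) → ℝ), IsNondegenerateHyperquadric Q ∧ Set.range F ⊆ Q

end AffineHypersurface

end

/-! Two classical facts about the cubic form `C` drive the proof: it is totally symmetric (Codazzi,
`cubicForm_symm_left` and `cubicForm_symm_right`) and trace-free (`apolarity`).

From semi-parallel to quadric. Constant sectional curvature `κ` means `R̂(X,Y)Z = κ(h(Y,Z)X -
h(X,Z)Y)`, and the Ricci identity makes `R̂ · C` an algebraic expression in `R̂` and `C`. If `κ =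
0`, then `h` is flat. If `κ ≠ 0`, contracting `R̂ · C = 0` with the inverse metric and using
symmetry and apolarity leaves `(n + 1) C = 0` (`cubicForm_eq_zero_of_semiParallel`). Hence `∇ = ∇̂`,
and as `n ≥ 2` the Gauss equation forces `S = κ id`, so that `v = ξ + κ F` is a constant vector. The
bilinear form on the ambient space that equals `h` on tangent vectors and makes `ξ` orthogonal to
them with `(ξ, ξ) = κ` is then parallel (`pd_ambientForm`), hence locally a constant matrix `A`, and
`(v - κ F)ᵀ A (v - κ F) = κ`. An open piece of the hypersurface determines such an `A`, so
connectedness makes it global (`exists_global_form`).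

From quadric to semi-parallel. Let `G = A F + b`, half the gradient of the quadratic polynomial
along `F`, and put `φ = G ⬝ ξ`, `ψ = ξᵀ A ξ`. Successive derivatives of the equation of the quadric
show that `G` annihilates tangent vectors, that `A` restricts to `-φ h`, and that `φ C` is minus the
symmetrization of `h ⊗ a` with `a_k = ξᵀ A ∂_k F`. Taking the trace, apolarity gives `(n + 2) a =
0`. Since `φ ≠ 0` by nonsingularity of the extended matrix, `C = 0`; moreover `φ` and `ψ` are
constant, `S = -(ψ/φ) id`, and `h` has constant curvature `-ψ/φ`. The flat case is immediate from
the Ricci identity. -/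

namespace AffineHypersurface

/-! ### Partial derivatives in coordinates -/

section Calculus

variable {n : ℕ} {V : Type*} [NormedAddCommGroup V] [NormedSpace ℝ V]
  {U : Set (EuclideanSpace ℝ (Fin n))} {x : EuclideanSpace ℝ (Fin n)}

theorem differentiableAt_of_contDiffOn {g : EuclideanSpace ℝ (Fin n) → V} (hU : IsOpen U)
    (hg : ContDiffOn ℝ ∞ g U) (hx : x ∈ U) : DifferentiableAt ℝ g x :=
  (hg.contDiffAt (hU.mem_nhds hx)).differentiableAt (by simp)

theorem pd_congr {g g' : EuclideanSpace ℝ (Fin n) → V} (hU : IsOpen U) (h : Set.EqOn g g' U)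
    (hx : x ∈ U) (i : Fin n) : pd i g x = pd i g' x := by
  have : g =ᶠ[nhds x] g' := Filter.eventuallyEq_of_mem (hU.mem_nhds hx) h
  rw [pd, pd, this.fderiv_eq]

theorem contDiffOn_pd {g : EuclideanSpace ℝ (Fin n) → V} (hU : IsOpen U)
    (hg : ContDiffOn ℝ ∞ g U) (i : Fin n) : ContDiffOn ℝ ∞ (pd i g) U :=
  (hg.fderiv_of_isOpen (m := ∞) hU (by simp)).clm_apply contDiffOn_const

theorem pd_comm {g : EuclideanSpace ℝ (Fin n) → V} (hU : IsOpen U) (hg : ContDiffOn ℝ ∞ g U)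
    (hx : x ∈ U) (i j : Fin n) : pd i (pd j g) x = pd j (pd i g) x := by
  have hd : DifferentiableAt ℝ (fderiv ℝ g) x :=
    differentiableAt_of_contDiffOn hU (hg.fderiv_of_isOpen (m := ∞) hU (by simp)) hx
  have key : ∀ a b : Fin n, pd a (pd b g) x
      = fderiv ℝ (fderiv ℝ g) x (EuclideanSpace.single a 1) (EuclideanSpace.single b 1) := by
    intro a b
    have : pd b g = fun y => fderiv ℝ g y (EuclideanSpace.single b 1) := rfl
    rw [this, pd, fderiv_clm_apply hd (differentiableAt_const _)]
    simp
  rw [key, key]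
  exact (hg.contDiffAt (hU.mem_nhds hx)).isSymmSndFDerivAt (by simpa using ENat.LEInfty.out) _ _

theorem pd_const (i : Fin n) (c : V) : pd i (fun _ => c) x = 0 := by
  simp [pd]

theorem pd_add {g g' : EuclideanSpace ℝ (Fin n) → V} (hg : DifferentiableAt ℝ g x)
    (hg' : DifferentiableAt ℝ g' x) (i : Fin n) :
    pd i (fun y => g y + g' y) x = pd i g x + pd i g' x := by
  simp [pd, fderiv_fun_add hg hg']

theorem pd_sub {g g' : EuclideanSpace ℝ (Fin n) → V} (hg : DifferentiableAt ℝ g x)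
    (hg' : DifferentiableAt ℝ g' x) (i : Fin n) :
    pd i (fun y => g y - g' y) x = pd i g x - pd i g' x := by
  simp [pd, fderiv_fun_sub hg hg']

theorem pd_smul {a : EuclideanSpace ℝ (Fin n) → ℝ} {g : EuclideanSpace ℝ (Fin n) → V}
    (ha : DifferentiableAt ℝ a x) (hg : DifferentiableAt ℝ g x) (i : Fin n) :
    pd i (fun y => a y • g y) x = pd i a x • g x + a x • pd i g x := by
  simp [pd, fderiv_fun_smul ha hg, add_comm]

theorem pd_const_smul {g : EuclideanSpace ℝ (Fin n) → V} (hg : DifferentiableAt ℝ g x) (c : ℝ)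
    (i : Fin n) : pd i (fun y => c • g y) x = c • pd i g x := by
  rw [pd_smul (differentiableAt_const c) hg, pd_const]; simp

theorem pd_mul {a b : EuclideanSpace ℝ (Fin n) → ℝ} (ha : DifferentiableAt ℝ a x)
    (hb : DifferentiableAt ℝ b x) (i : Fin n) :
    pd i (fun y => a y * b y) x = pd i a x * b x + a x * pd i b x :=
  pd_smul ha hb i

theorem pd_pow {a : EuclideanSpace ℝ (Fin n) → ℝ} (ha : DifferentiableAt ℝ a x) (m : ℕ)
    (i : Fin n) : pd i (fun y => a y ^ m) x = m * a x ^ (m - 1) * pd i a x := by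
  simp [pd, fderiv_fun_pow m ha]

theorem pd_sum {ι : Type*} (s : Finset ι) {g : ι → EuclideanSpace ℝ (Fin n) → V}
    (hg : ∀ k, DifferentiableAt ℝ (g k) x) (i : Fin n) :
    pd i (fun y => ∑ k ∈ s, g k y) x = ∑ k ∈ s, pd i (g k) x := by
  simp [pd, fderiv_fun_sum fun k _ => hg k]

theorem pd_sum_mul {ι : Type*} (s : Finset ι) {a b : ι → EuclideanSpace ℝ (Fin n) → ℝ}
    (ha : ∀ k, DifferentiableAt ℝ (a k) x) (hb : ∀ k, DifferentiableAt ℝ (b k) x) (i : Fin n) :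
    pd i (fun y => ∑ k ∈ s, a k y * b k y) x
      = ∑ k ∈ s, (pd i (a k) x * b k x + a k x * pd i (b k) x) := by
  rw [pd_sum s fun k => (ha k).fun_mul (hb k)]
  exact Finset.sum_congr rfl fun k _ => pd_mul (ha k) (hb k) i

theorem pd_apply {ι : Type*} [Fintype ι] {g : EuclideanSpace ℝ (Fin n) → ι → ℝ}
    (hg : DifferentiableAt ℝ g x) (i : Fin n) (r : ι) :
    pd i (fun y => g y r) x = pd i g x r := by
  rw [pd, pd, fderiv_apply hg]
  rfl

theorem contDiffOn_det {ι : Type*} [Fintype ι] [DecidableEq ι]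
    {B : EuclideanSpace ℝ (Fin n) → Matrix ι ι ℝ}
    (hB : ∀ r c, ContDiffOn ℝ ∞ (fun y => B y r c) U) : ContDiffOn ℝ ∞ (fun y => (B y).det) U := by
  simp only [Matrix.det_apply']
  exact ContDiffOn.sum fun σ _ => contDiffOn_const.mul (contDiffOn_prod fun r _ => hB _ _)

theorem contDiffOn_inv {ι : Type*} [Fintype ι] [DecidableEq ι]
    {B : EuclideanSpace ℝ (Fin n) → Matrix ι ι ℝ}
    (hB : ∀ r c, ContDiffOn ℝ ∞ (fun y => B y r c) U) (hd : ∀ y ∈ U, (B y).det ≠ 0) (r c : ι) :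
    ContDiffOn ℝ ∞ (fun y => (B y)⁻¹ r c) U := by
  simp only [Matrix.inv_def, Matrix.smul_apply, smul_eq_mul, Ring.inverse_eq_inv',
    Matrix.adjugate_apply]
  refine ((contDiffOn_det hB).inv hd).mul (contDiffOn_det fun a b => ?_)
  by_cases h : a = c
  · subst h; simpa using contDiffOn_const
  · simpa [Matrix.updateRow_ne h] using hB a b

/-- The derivative of a determinant, column by column. -/
theorem pd_det {ι : Type*} [Fintype ι] [DecidableEq ι]
    {B : EuclideanSpace ℝ (Fin n) → Matrix ι ι ℝ}
    (hB : ∀ r c, DifferentiableAt ℝ (fun y => B y r c) x) (i : Fin n) :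
    pd i (fun y => (B y).det) x
      = ∑ c, (B x).cramer (fun r => pd i (fun y => B y r c) x) c := by
  have hd : ∀ σ : Equiv.Perm ι, HasFDerivAt (fun y => ∏ c, B y (σ c) c)
      (∑ c, (∏ j ∈ Finset.univ.erase c, B x (σ j) j) • fderiv ℝ (fun y => B y (σ c) c) x) x :=
    fun σ => HasFDerivAt.finsetProd fun c _ => (hB (σ c) c).hasFDerivAt
  simp only [Matrix.det_apply', Matrix.cramer_apply]
  rw [pd_sum _ fun σ => (differentiableAt_const _).fun_mul (hd σ).differentiableAt,
    Finset.sum_comm]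
  refine Finset.sum_congr rfl fun σ _ => ?_
  rw [pd_mul (differentiableAt_const _) (hd σ).differentiableAt, pd_const, ← Finset.mul_sum]
  simp only [zero_mul, zero_add]
  congr 1
  rw [pd, (hd σ).fderiv]
  simp only [sum_apply, smul_apply, smul_eq_mul]
  refine Finset.sum_congr rfl fun c _ => ?_
  rw [← Finset.mul_prod_erase _ _ (Finset.mem_univ c), mul_comm]
  congr 1
  · simp [pd]
  · exact Finset.prod_congr rfl fun j hj => by
      rw [Matrix.updateCol_ne (Finset.ne_of_mem_erase hj)]

theorem fderiv_eq_zero_of_pd {g : EuclideanSpace ℝ (Fin n) → V}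
    (h : ∀ i, pd i g x = 0) : fderiv ℝ g x = 0 := by
  have : (fderiv ℝ g x : EuclideanSpace ℝ (Fin n) →ₗ[ℝ] V) = 0 := by
    refine (EuclideanSpace.basisFun (Fin n) ℝ).toBasis.ext fun i => ?_
    simpa [pd] using h i
  ext v
  exact LinearMap.congr_fun this v

end Calculus

/-! ### Structure equations of a Blaschke patch: Gauss, Weingarten, Codazzi, apolarity -/

section Patch

variable {n : ℕ}

/-- A local parametrization `f : U → ℝ^(n+1)` of a non-degenerate hypersurface with affine
normal `ξ`. The volume condition is stated without absolute values and roots. -/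
structure IsBlaschkePatch (f ξ : EuclideanSpace ℝ (Fin n) → Fin (n + 1) → ℝ)
    (U : Set (EuclideanSpace ℝ (Fin n))) : Prop where
  isOpen : IsOpen U
  smooth : ContDiffOn ℝ ∞ f U
  smooth_normal : ContDiffOn ℝ ∞ ξ U
  det_frame : ∀ x ∈ U, (frame f ξ x).det ≠ 0
  tangent : ∀ x ∈ U, ∀ i, ((frame f ξ x)⁻¹ *ᵥ pd i ξ x) (Fin.last n) = 0
  det_metric : ∀ x ∈ U, (metric f ξ x).det ≠ 0
  volume : ∀ x ∈ U, (frame f ξ x).det ^ 4 = (metric f ξ x).det ^ 2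

/-- The components `∂_i ξ = ∑ k, W_i^k ∂_k f` of the derivative of the affine normal; they are
the components of `-S`, where `S` is the shape operator. -/
noncomputable def weingarten (f ξ : EuclideanSpace ℝ (Fin n) → Fin (n + 1) → ℝ) (i k : Fin n)
    (x : EuclideanSpace ℝ (Fin n)) : ℝ :=
  ((frame f ξ x)⁻¹ *ᵥ pd i ξ x) k.castSucc

theorem frame_mulVec (f ξ : EuclideanSpace ℝ (Fin n) → Fin (n + 1) → ℝ)
    (x : EuclideanSpace ℝ (Fin n)) (w : Fin (n + 1) → ℝ) :
    frame f ξ x *ᵥ w = ∑ k : Fin n, w k.castSucc • pd k f x + w (Fin.last n) • ξ x := by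
  ext r
  simp [Matrix.mulVec, dotProduct, frame, Fin.sum_univ_castSucc, mul_comm]

variable {f ξ : EuclideanSpace ℝ (Fin n) → Fin (n + 1) → ℝ}
  {U : Set (EuclideanSpace ℝ (Fin n))} {x : EuclideanSpace ℝ (Fin n)}

namespace IsBlaschkePatch

theorem smooth_frame (P : IsBlaschkePatch f ξ U) (r c : Fin (n + 1)) :
    ContDiffOn ℝ ∞ (fun y => frame f ξ y r c) U := by
  refine Fin.lastCases ?_ (fun k => ?_) c
  · simpa [frame] using contDiffOn_pi.1 P.smooth_normal r
  · simpa [frame] using contDiffOn_pi.1 (contDiffOn_pd P.isOpen P.smooth k) r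

theorem smooth_inv_mulVec (P : IsBlaschkePatch f ξ U)
    {g : EuclideanSpace ℝ (Fin n) → Fin (n + 1) → ℝ} (hg : ContDiffOn ℝ ∞ g U)
    (c : Fin (n + 1)) : ContDiffOn ℝ ∞ (fun y => ((frame f ξ y)⁻¹ *ᵥ g y) c) U := by
  simp only [Matrix.mulVec, dotProduct]
  exact ContDiffOn.sum fun r _ =>
    (contDiffOn_inv P.smooth_frame P.det_frame c r).mul (contDiffOn_pi.1 hg r)

theorem smooth_gaussCoeff (P : IsBlaschkePatch f ξ U) (i j : Fin n) (c : Fin (n + 1)) :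
    ContDiffOn ℝ ∞ (fun y => gaussCoeff f ξ i j y c) U :=
  P.smooth_inv_mulVec (contDiffOn_pd P.isOpen (contDiffOn_pd P.isOpen P.smooth j) i) c

theorem smooth_metric (P : IsBlaschkePatch f ξ U) (i j : Fin n) :
    ContDiffOn ℝ ∞ (fun y => metric f ξ y i j) U :=
  P.smooth_gaussCoeff i j _

theorem smooth_affineChristoffel (P : IsBlaschkePatch f ξ U) (i j k : Fin n) :
    ContDiffOn ℝ ∞ (affineChristoffel f ξ i j k) U :=
  P.smooth_gaussCoeff i j _

theorem smooth_leviCivita (P : IsBlaschkePatch f ξ U) (i j k : Fin n) :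
    ContDiffOn ℝ ∞ (leviCivita f ξ i j k) U := by
  have h : ∀ a b c, ContDiffOn ℝ ∞ (pd a fun y => metric f ξ y b c) U := fun a b c =>
    contDiffOn_pd P.isOpen (P.smooth_metric b c) a
  exact contDiffOn_const.mul (ContDiffOn.sum fun l _ =>
    (contDiffOn_inv P.smooth_metric P.det_metric k l).mul
      (((h i j l).add (h j i l)).sub (h l i j)))

theorem smooth_cubicForm (P : IsBlaschkePatch f ξ U) (i j k : Fin n) :
    ContDiffOn ℝ ∞ (cubicForm f ξ i j k) U :=
  ((contDiffOn_pd P.isOpen (P.smooth_metric j k) i).sub (ContDiffOn.sum fun l _ =>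
    (P.smooth_affineChristoffel i j l).mul (P.smooth_metric l k))).sub (ContDiffOn.sum fun l _ =>
    (P.smooth_affineChristoffel i k l).mul (P.smooth_metric j l))

theorem diff (P : IsBlaschkePatch f ξ U) {V : Type*} [NormedAddCommGroup V] [NormedSpace ℝ V]
    {g : EuclideanSpace ℝ (Fin n) → V} (hx : x ∈ U)
    (hg : ContDiffOn ℝ ∞ g U) : DifferentiableAt ℝ g x :=
  differentiableAt_of_contDiffOn P.isOpen hg hx

theorem frame_mulVec_inv (P : IsBlaschkePatch f ξ U) (hx : x ∈ U) (v : Fin (n + 1) → ℝ) :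
    frame f ξ x *ᵥ ((frame f ξ x)⁻¹ *ᵥ v) = v := by
  rw [Matrix.mulVec_mulVec, Matrix.mul_nonsing_inv _ (P.det_frame x hx).isUnit, Matrix.one_mulVec]

/-- The Gauss formula. -/
theorem gauss (P : IsBlaschkePatch f ξ U) (hx : x ∈ U) (i j : Fin n) :
    pd i (pd j f) x
      = ∑ k, affineChristoffel f ξ i j k x • pd k f x + metric f ξ x i j • ξ x := by
  rw [← P.frame_mulVec_inv hx (pd i (pd j f) x), frame_mulVec]
  rfl

/-- The Weingarten formula. -/
theorem pd_normal (P : IsBlaschkePatch f ξ U) (hx : x ∈ U) (i : Fin n) :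
    pd i ξ x = ∑ k, weingarten f ξ i k x • pd k f x := by
  rw [← P.frame_mulVec_inv hx (pd i ξ x), frame_mulVec, P.tangent x hx i]
  simp [weingarten]

theorem frame_coeff_eq (P : IsBlaschkePatch f ξ U) (hx : x ∈ U) {a b : Fin n → ℝ} {α β : ℝ}
    (h : ∑ k, a k • pd k f x + α • ξ x = ∑ k, b k • pd k f x + β • ξ x) :
    (∀ k, a k = b k) ∧ α = β := by
  have key : frame f ξ x *ᵥ (Fin.snoc (α := fun _ => ℝ) a α)
      = frame f ξ x *ᵥ (Fin.snoc (α := fun _ => ℝ) b β) := by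
    simpa [frame_mulVec] using h
  have := Matrix.mulVec_injective_of_isUnit
    ((Matrix.isUnit_iff_isUnit_det _).2 (P.det_frame x hx).isUnit) key
  exact ⟨fun k => by simpa using congrFun this k.castSucc,
    by simpa using congrFun this (Fin.last n)⟩

theorem metric_symm (P : IsBlaschkePatch f ξ U) (hx : x ∈ U) (i j : Fin n) :
    metric f ξ x i j = metric f ξ x j i := by
  simp only [metric, Matrix.of_apply, gaussCoeff, pd_comm P.isOpen P.smooth hx i j]

theorem affineChristoffel_symm (P : IsBlaschkePatch f ξ U) (hx : x ∈ U) (i j k : Fin n) :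
    affineChristoffel f ξ i j k x = affineChristoffel f ξ j i k x := by
  simp only [affineChristoffel, gaussCoeff, pd_comm P.isOpen P.smooth hx i j]

theorem inv_metric_symm (P : IsBlaschkePatch f ξ U) (hx : x ∈ U) (i j : Fin n) :
    (metric f ξ x)⁻¹ i j = (metric f ξ x)⁻¹ j i := by
  have h : (metric f ξ x)ᵀ = metric f ξ x := by
    ext a b; exact P.metric_symm hx b a
  conv_lhs => rw [← h, ← Matrix.transpose_nonsing_inv]
  rfl

theorem inv_metric_mul (P : IsBlaschkePatch f ξ U) (hx : x ∈ U) (i j : Fin n) :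
    ∑ l, (metric f ξ x)⁻¹ i l * metric f ξ x l j = if i = j then 1 else 0 := by
  rw [← Matrix.mul_apply, Matrix.nonsing_inv_mul _ (P.det_metric x hx).isUnit, Matrix.one_apply]

theorem metric_mul_inv (P : IsBlaschkePatch f ξ U) (hx : x ∈ U) (i j : Fin n) :
    ∑ l, metric f ξ x i l * (metric f ξ x)⁻¹ l j = if i = j then 1 else 0 := by
  rw [← Matrix.mul_apply, Matrix.mul_nonsing_inv _ (P.det_metric x hx).isUnit, Matrix.one_apply]

/-- Differentiate the Gauss formula and substitute the Gauss and Weingarten formulas for the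
derivatives of the frame that appear. -/
theorem pd_gauss (P : IsBlaschkePatch f ξ U) (hx : x ∈ U) (a i j : Fin n) :
    pd a (pd i (pd j f)) x
      = ∑ k, (pd a (affineChristoffel f ξ i j k) x
          + ∑ m, affineChristoffel f ξ i j m x * affineChristoffel f ξ a m k x
          + metric f ξ x i j * weingarten f ξ a k x) • pd k f x
        + (pd a (fun y => metric f ξ y i j) x
          + ∑ m, affineChristoffel f ξ i j m x * metric f ξ x a m) • ξ x := by
  have hΓ := fun k => P.diff hx (P.smooth_affineChristoffel i j k)
  have hf := fun k => P.diff hx (contDiffOn_pd P.isOpen P.smooth k)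
  have hh := P.diff hx (P.smooth_metric i j)
  have hξ := P.diff hx P.smooth_normal
  have e : Set.EqOn (pd i (pd j f)) (fun y => ∑ k, affineChristoffel f ξ i j k y • pd k f y
      + metric f ξ y i j • ξ y) U := fun y hy => P.gauss hy i j
  rw [pd_congr P.isOpen e hx, pd_add (DifferentiableAt.fun_sum fun k _ => (hΓ k).fun_smul (hf k))
    (hh.fun_smul hξ), pd_sum _ fun k => (hΓ k).fun_smul (hf k), pd_smul hh hξ, P.pd_normal hx]
  simp only [fun k => pd_smul (hΓ k) (hf k) a, P.gauss hx, add_smul, Finset.sum_add_distrib,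
    smul_add, Finset.smul_sum, Finset.sum_smul, smul_smul]
  rw [Finset.sum_comm (f := fun k m => (affineChristoffel f ξ i j m x *
    affineChristoffel f ξ a m k x) • pd k f x)]
  abel

/-- Integrability conditions: third derivatives of `f` commute. The tangential components are the
Gauss equation, the `ξ`-component is the Codazzi equation for `h`. -/
theorem codazzi_aux (P : IsBlaschkePatch f ξ U) (hx : x ∈ U) (a i j : Fin n) :
    (∀ k, pd a (affineChristoffel f ξ i j k) x
          + ∑ m, affineChristoffel f ξ i j m x * affineChristoffel f ξ a m k x
          + metric f ξ x i j * weingarten f ξ a k x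
        = pd i (affineChristoffel f ξ a j k) x
          + ∑ m, affineChristoffel f ξ a j m x * affineChristoffel f ξ i m k x
          + metric f ξ x a j * weingarten f ξ i k x) ∧
      pd a (fun y => metric f ξ y i j) x + ∑ m, affineChristoffel f ξ i j m x * metric f ξ x a m
        = pd i (fun y => metric f ξ y a j) x
          + ∑ m, affineChristoffel f ξ a j m x * metric f ξ x i m := by
  have h := pd_comm P.isOpen (contDiffOn_pd P.isOpen P.smooth j) hx a i
  rw [P.pd_gauss hx, P.pd_gauss hx] at h
  exact P.frame_coeff_eq hx h

theorem cubicForm_symm_right (P : IsBlaschkePatch f ξ U) (hx : x ∈ U) (i j k : Fin n) :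
    cubicForm f ξ i j k x = cubicForm f ξ i k j x := by
  have e : Set.EqOn (fun y => metric f ξ y j k) (fun y => metric f ξ y k j) U :=
    fun y hy => P.metric_symm hy j k
  have h1 : ∀ l, metric f ξ x l k = metric f ξ x k l := fun l => P.metric_symm hx l k
  have h2 : ∀ l, metric f ξ x l j = metric f ξ x j l := fun l => P.metric_symm hx l j
  rw [cubicForm, cubicForm, pd_congr P.isOpen e hx]
  simp only [h1, h2]
  ring

/-- The Codazzi equation for the affine metric. -/
theorem cubicForm_symm_left (P : IsBlaschkePatch f ξ U) (hx : x ∈ U) (i j k : Fin n) :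
    cubicForm f ξ i j k x = cubicForm f ξ j i k x := by
  have h := (P.codazzi_aux hx i j k).2
  have hΓ : ∀ l, affineChristoffel f ξ i j l x = affineChristoffel f ξ j i l x :=
    P.affineChristoffel_symm hx i j
  simp only [cubicForm, hΓ]
  linarith

/-- The trace of the induced connection is the logarithmic derivative of its volume form. -/
theorem pd_det_frame (P : IsBlaschkePatch f ξ U) (hx : x ∈ U) (k : Fin n) :
    pd k (fun y => (frame f ξ y).det) x
      = (frame f ξ x).det * ∑ i, affineChristoffel f ξ k i i x := by
  -- Cramer's rule: replacing a column by a vector multiplies the determinant by the corresponding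
  -- frame coordinate of that vector. The coordinate of `∂_k ξ` along `ξ` vanishes, so only the
  -- trace of `Γ` survives.
  have key : ∀ c, (frame f ξ x).cramer ((frame f ξ x) *ᵥ ((frame f ξ x)⁻¹ *ᵥ
      (fun r => pd k (fun y => frame f ξ y r c) x))) c
      = (frame f ξ x).det * ((frame f ξ x)⁻¹ *ᵥ (fun r => pd k (fun y => frame f ξ y r c) x)) c := by
    intro c
    rw [Matrix.cramer_eq_adjugate_mulVec, Matrix.mulVec_mulVec, Matrix.adjugate_mul,
      Matrix.smul_mulVec, Matrix.one_mulVec]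
    rfl
  rw [pd_det fun r c => P.diff hx (P.smooth_frame r c)]
  simp only [P.frame_mulVec_inv hx] at key
  simp only [key]
  rw [← Finset.mul_sum, Fin.sum_univ_castSucc]
  have h1 : (fun r => pd k (fun y => frame f ξ y r (Fin.last n)) x) = pd k ξ x := by
    ext r
    simpa [frame] using pd_apply (P.diff hx P.smooth_normal) k r
  have h2 : ∀ i : Fin n, (fun r => pd k (fun y => frame f ξ y r i.castSucc) x)
      = pd k (pd i f) x := by
    intro i
    ext r
    simpa [frame] using pd_apply (P.diff hx (contDiffOn_pd P.isOpen P.smooth i)) k r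
  simp only [h1, h2, P.tangent x hx k, add_zero]
  rfl

/-- Jacobi's formula, with the adjugate written as determinant times inverse. -/
theorem pd_det_metric (P : IsBlaschkePatch f ξ U) (hx : x ∈ U) (k : Fin n) :
    pd k (fun y => (metric f ξ y).det) x
      = (metric f ξ x).det * ∑ i, ∑ j, (metric f ξ x)⁻¹ i j * pd k (fun y => metric f ξ y j i) x := by
  rw [pd_det fun r c => P.diff hx (P.smooth_metric r c), Finset.mul_sum]
  refine Finset.sum_congr rfl fun i _ => ?_
  rw [Matrix.cramer_eq_adjugate_mulVec]
  have : (metric f ξ x).adjugate = (metric f ξ x).det • (metric f ξ x)⁻¹ := by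
    rw [Matrix.inv_def, smul_smul, Ring.mul_inverse_cancel _ (P.det_metric x hx).isUnit, one_smul]
  rw [this, Matrix.smul_mulVec]
  rfl

/-- Apolarity: the cubic form is trace-free. -/
theorem apolarity (P : IsBlaschkePatch f ξ U) (hx : x ∈ U) (k : Fin n) :
    ∑ i, ∑ j, (metric f ξ x)⁻¹ i j * cubicForm f ξ k j i x = 0 := by
  have hD := P.diff hx (contDiffOn_det P.smooth_frame)
  have hH := P.diff hx (contDiffOn_det P.smooth_metric)
  have e : Set.EqOn (fun y => (frame f ξ y).det ^ 4) (fun y => (metric f ξ y).det ^ 2) U :=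
    fun y hy => P.volume y hy
  have h := pd_congr P.isOpen e hx k
  rw [pd_pow hD, pd_pow hH, P.pd_det_frame hx, P.pd_det_metric hx] at h
  have hv := P.volume x hx
  have hd := P.det_metric x hx
  set D := (frame f ξ x).det
  set H := (metric f ξ x).det
  set τ := ∑ i, affineChristoffel f ξ k i i x with hτ
  set t := ∑ i, ∑ j, (metric f ξ x)⁻¹ i j * pd k (fun y => metric f ξ y j i) x with ht
  -- Logarithmic derivative of `D ^ 4 = H ^ 2`. Each of the two connection terms of `C` has trace
  -- `τ` (`s1`, `s2`), so the trace of `C` is `t - 2 * τ`.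
  have h' : t = 2 * τ := by
    have : 2 * H ^ 2 * t = 2 * H ^ 2 * (2 * τ) := by
      push_cast at h
      linear_combination -h + 4 * τ * hv
    exact mul_left_cancel₀ (by positivity) this
  have s1 : ∑ i, ∑ j, (metric f ξ x)⁻¹ i j *
      ∑ l, affineChristoffel f ξ k j l x * metric f ξ x l i = τ := by
    simp only [Finset.mul_sum]
    rw [Finset.sum_comm]
    refine Finset.sum_congr rfl fun j _ => ?_
    rw [Finset.sum_comm]
    calc _ = ∑ l, affineChristoffel f ξ k j l x *
          ∑ i, metric f ξ x l i * (metric f ξ x)⁻¹ i j := by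
          refine Finset.sum_congr rfl fun l _ => ?_
          rw [Finset.mul_sum]
          exact Finset.sum_congr rfl fun i _ => by ring
      _ = _ := by simp [P.metric_mul_inv hx]
  have s2 : ∑ i, ∑ j, (metric f ξ x)⁻¹ i j *
      ∑ l, affineChristoffel f ξ k i l x * metric f ξ x j l = τ := by
    simp only [Finset.mul_sum]
    refine Finset.sum_congr rfl fun i _ => ?_
    rw [Finset.sum_comm]
    calc _ = ∑ l, affineChristoffel f ξ k i l x *
          ∑ j, (metric f ξ x)⁻¹ i j * metric f ξ x j l := by
          refine Finset.sum_congr rfl fun l _ => ?_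
          rw [Finset.mul_sum]
          exact Finset.sum_congr rfl fun j _ => by ring
      _ = _ := by simp [P.inv_metric_mul hx]
  simp only [cubicForm, mul_sub, Finset.sum_sub_distrib, s1, s2, ← ht, h']
  ring

end IsBlaschkePatch

end Patch

/-! ### Ricci identity and symmetries of the curvature tensor of the affine metric -/

section CurvatureIdentities

variable {n : ℕ} {f ξ : EuclideanSpace ℝ (Fin n) → Fin (n + 1) → ℝ}
  {U : Set (EuclideanSpace ℝ (Fin n))} {x : EuclideanSpace ℝ (Fin n)}

/-- Matches the mixed terms, in which two connection symbols act on different indices of a tensor;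
they cancel in the commutator of covariant derivatives. -/
theorem sum_mul_sum_mul_swap (u v : Fin n → ℝ) (S : Fin n → Fin n → ℝ) :
    ∑ m, u m * ∑ l, v l * S m l = ∑ m, v m * ∑ l, u l * S l m := by
  simp only [Finset.mul_sum]
  rw [Finset.sum_comm]
  exact Finset.sum_congr rfl fun _ _ => Finset.sum_congr rfl fun _ _ => by ring

theorem sum_sum_mul_mul (u t : Fin n → ℝ) (B : Fin n → Fin n → ℝ) :
    ∑ l, (∑ m, u m * B m l) * t l = ∑ m, u m * ∑ l, B m l * t l := by
  simp only [Finset.mul_sum, Finset.sum_mul]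
  rw [Finset.sum_comm]
  exact Finset.sum_congr rfl fun _ _ => Finset.sum_congr rfl fun _ _ => by ring

theorem sum_curvature_mul (i j a : Fin n) (t : Fin n → ℝ) :
    ∑ l, curvature f ξ i j a l x * t l
      = ∑ l, pd i (leviCivita f ξ j a l) x * t l - ∑ l, pd j (leviCivita f ξ i a l) x * t l
        + ∑ m, leviCivita f ξ j a m x * ∑ l, leviCivita f ξ i m l x * t l
        - ∑ m, leviCivita f ξ i a m x * ∑ l, leviCivita f ξ j m l x * t l := by
  rw [← sum_sum_mul_mul, ← sum_sum_mul_mul]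
  simp only [curvature, add_mul, sub_mul, Finset.sum_sub_distrib, Finset.sum_add_distrib]
  ring

namespace IsBlaschkePatch

theorem pd_covDeriv (P : IsBlaschkePatch f ξ U) (hx : x ∈ U)
    {T : Fin n → Fin n → Fin n → EuclideanSpace ℝ (Fin n) → ℝ}
    (hT : ∀ a b c, ContDiffOn ℝ ∞ (T a b c) U) (i j a b c : Fin n) :
    pd i (covDeriv f ξ j T a b c) x
      = pd i (pd j (T a b c)) x
        - (∑ l, pd i (leviCivita f ξ j a l) x * T l b c x
          + ∑ l, leviCivita f ξ j a l x * pd i (T l b c) x)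
        - (∑ l, pd i (leviCivita f ξ j b l) x * T a l c x
          + ∑ l, leviCivita f ξ j b l x * pd i (T a l c) x)
        - (∑ l, pd i (leviCivita f ξ j c l) x * T a b l x
          + ∑ l, leviCivita f ξ j c l x * pd i (T a b l) x) := by
  have hG := fun p q r => P.diff hx (P.smooth_leviCivita p q r)
  have hd := fun p q r => P.diff hx (hT p q r)
  have h0 := P.diff hx (contDiffOn_pd P.isOpen (hT a b c) j)
  have h1 : DifferentiableAt ℝ (fun y => ∑ l, leviCivita f ξ j a l y * T l b c y) x :=
    DifferentiableAt.fun_sum fun l _ => (hG j a l).fun_mul (hd l b c)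
  have h2 : DifferentiableAt ℝ (fun y => ∑ l, leviCivita f ξ j b l y * T a l c y) x :=
    DifferentiableAt.fun_sum fun l _ => (hG j b l).fun_mul (hd a l c)
  have h3 : DifferentiableAt ℝ (fun y => ∑ l, leviCivita f ξ j c l y * T a b l y) x :=
    DifferentiableAt.fun_sum fun l _ => (hG j c l).fun_mul (hd a b l)
  have e : covDeriv f ξ j T a b c = fun y => pd j (T a b c) y
    - ∑ l, leviCivita f ξ j a l y * T l b c y
    - ∑ l, leviCivita f ξ j b l y * T a l c y
    - ∑ l, leviCivita f ξ j c l y * T a b l y := rfl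
  rw [e, pd_sub ((h0.fun_sub h1).fun_sub h2) h3, pd_sub (h0.fun_sub h1) h2, pd_sub h0 h1,
    pd_sum_mul _ (hG j a) fun l => hd l b c, pd_sum_mul _ (hG j b) fun l => hd a l c,
    pd_sum_mul _ (hG j c) fun l => hd a b l]
  simp only [Finset.sum_add_distrib]

/-- The Ricci identity for `(0,3)`-tensor fields. -/
theorem ricci_identity (P : IsBlaschkePatch f ξ U) (hx : x ∈ U)
    {T : Fin n → Fin n → Fin n → EuclideanSpace ℝ (Fin n) → ℝ}
    (hT : ∀ a b c, ContDiffOn ℝ ∞ (T a b c) U) (i j a b c : Fin n) :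
    covDeriv f ξ i (covDeriv f ξ j T) a b c x - covDeriv f ξ j (covDeriv f ξ i T) a b c x
      = -(∑ l, curvature f ξ i j a l x * T l b c x) - ∑ l, curvature f ξ i j b l x * T a l c x
        - ∑ l, curvature f ξ i j c l x * T a b l x := by
  have e : ∀ i j, covDeriv f ξ i (covDeriv f ξ j T) a b c x = pd i (covDeriv f ξ j T a b c) x
      - ∑ m, leviCivita f ξ i a m x * (pd j (T m b c) x
        - ∑ l, leviCivita f ξ j m l x * T l b c x - ∑ l, leviCivita f ξ j b l x * T m l c x
        - ∑ l, leviCivita f ξ j c l x * T m b l x)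
      - ∑ m, leviCivita f ξ i b m x * (pd j (T a m c) x
        - ∑ l, leviCivita f ξ j a l x * T l m c x - ∑ l, leviCivita f ξ j m l x * T a l c x
        - ∑ l, leviCivita f ξ j c l x * T a m l x)
      - ∑ m, leviCivita f ξ i c m x * (pd j (T a b m) x
        - ∑ l, leviCivita f ξ j a l x * T l b m x - ∑ l, leviCivita f ξ j b l x * T a l m x
        - ∑ l, leviCivita f ξ j m l x * T a b l x) := fun i j => rfl
  rw [e, e, P.pd_covDeriv hx hT, P.pd_covDeriv hx hT, pd_comm P.isOpen (hT a b c) hx i j]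
  simp only [mul_sub, Finset.sum_sub_distrib, sum_curvature_mul]
  rw [sum_mul_sum_mul_swap (fun m => leviCivita f ξ i a m x) (fun l => leviCivita f ξ j b l x)
      fun m l => T m l c x,
    sum_mul_sum_mul_swap (fun m => leviCivita f ξ i a m x) (fun l => leviCivita f ξ j c l x)
      fun m l => T m b l x,
    sum_mul_sum_mul_swap (fun m => leviCivita f ξ i b m x) (fun l => leviCivita f ξ j a l x)
      fun m l => T l m c x,
    sum_mul_sum_mul_swap (fun m => leviCivita f ξ i b m x) (fun l => leviCivita f ξ j c l x)
      fun m l => T a m l x,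
    sum_mul_sum_mul_swap (fun m => leviCivita f ξ i c m x) (fun l => leviCivita f ξ j a l x)
      fun m l => T l b m x,
    sum_mul_sum_mul_swap (fun m => leviCivita f ξ i c m x) (fun l => leviCivita f ξ j b l x)
      fun m l => T a l m x]
  ring

/-- The Ricci identity removes all derivatives of `C`, so semi-parallelism becomes a pointwise
algebraic condition. -/
theorem curvatureDotCubic_eq (P : IsBlaschkePatch f ξ U) (hx : x ∈ U) (i j a b c : Fin n) :
    curvatureDotCubic f ξ i j a b c x
      = -(∑ l, curvature f ξ i j a l x * cubicForm f ξ l b c x)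
        - ∑ l, curvature f ξ i j b l x * cubicForm f ξ a l c x
        - ∑ l, curvature f ξ i j c l x * cubicForm f ξ a b l x :=
  P.ricci_identity hx P.smooth_cubicForm i j a b c

theorem pd_metric_symm (P : IsBlaschkePatch f ξ U) (hx : x ∈ U) (i j k : Fin n) :
    pd i (fun y => metric f ξ y j k) x = pd i (fun y => metric f ξ y k j) x :=
  pd_congr P.isOpen (fun _ hy => P.metric_symm hy j k) hx i

theorem leviCivita_lower (P : IsBlaschkePatch f ξ U) (hx : x ∈ U) (i j l : Fin n) :
    ∑ k, leviCivita f ξ i j k x * metric f ξ x k l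
      = (1 / 2) * (pd i (fun y => metric f ξ y j l) x + pd j (fun y => metric f ξ y i l) x
        - pd l (fun y => metric f ξ y i j) x) := by
  set t : Fin n → ℝ := fun l => pd i (fun y => metric f ξ y j l) x
    + pd j (fun y => metric f ξ y i l) x - pd l (fun y => metric f ξ y i j) x with ht
  have : ∀ k, leviCivita f ξ i j k x = (1 / 2) * ∑ m, t m * (metric f ξ x)⁻¹ m k := by
    intro k
    rw [leviCivita]
    congr 1
    exact Finset.sum_congr rfl fun m _ => by rw [P.inv_metric_symm hx k m, mul_comm]
  simp only [this, mul_assoc, ← Finset.mul_sum]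
  rw [sum_sum_mul_mul t _ fun m k => (metric f ξ x)⁻¹ m k]
  simp [P.inv_metric_mul hx, ht]

/-- The Levi-Civita connection is metric. -/
theorem pd_metric (P : IsBlaschkePatch f ξ U) (hx : x ∈ U) (i j k : Fin n) :
    pd i (fun y => metric f ξ y j k) x
      = ∑ l, leviCivita f ξ i j l x * metric f ξ x l k
        + ∑ l, leviCivita f ξ i k l x * metric f ξ x l j := by
  rw [P.leviCivita_lower hx, P.leviCivita_lower hx, P.pd_metric_symm hx i k j,
    P.pd_metric_symm hx j i k, P.pd_metric_symm hx k i j]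
  rw [P.pd_metric_symm hx j k i, P.pd_metric_symm hx k j i]
  ring

theorem leviCivita_symm (P : IsBlaschkePatch f ξ U) (hx : x ∈ U) (i j k : Fin n) :
    leviCivita f ξ i j k x = leviCivita f ξ j i k x := by
  simp only [leviCivita, P.pd_metric_symm hx _ i j]
  congr 1
  exact Finset.sum_congr rfl fun l _ => by ring

theorem pd_leviCivita_symm (P : IsBlaschkePatch f ξ U) (hx : x ∈ U) (a i j k : Fin n) :
    pd a (leviCivita f ξ i j k) x = pd a (leviCivita f ξ j i k) x :=
  pd_congr P.isOpen (fun _ hy => P.leviCivita_symm hy i j k) hx a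

theorem curvature_antisymm (i j k l : Fin n) :
    curvature f ξ i j k l x = -curvature f ξ j i k l x := by
  simp only [curvature, Finset.sum_sub_distrib]
  ring

/-- The first Bianchi identity. -/
theorem curvature_bianchi (P : IsBlaschkePatch f ξ U) (hx : x ∈ U) (i j k l : Fin n) :
    curvature f ξ i j k l x + curvature f ξ j k i l x + curvature f ξ k i j l x = 0 := by
  simp only [curvature, Finset.sum_sub_distrib]
  simp only [P.pd_leviCivita_symm hx _ k i, P.pd_leviCivita_symm hx _ k j,
    P.pd_leviCivita_symm hx _ j i, P.leviCivita_symm hx k i, P.leviCivita_symm hx k j,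
    P.leviCivita_symm hx j i]
  ring

/-- Since `∇̂ h = 0`, the symmetry of the second derivatives of `h_kl` says that `R̂(∂_i, ∂_j)`
annihilates `h`. -/
theorem curvature_lower_antisymm (P : IsBlaschkePatch f ξ U) (hx : x ∈ U) (i j k l : Fin n) :
    ∑ m, curvature f ξ i j k m x * metric f ξ x m l
      + ∑ m, curvature f ξ i j l m x * metric f ξ x m k = 0 := by
  have hG := fun p q r => P.diff hx (P.smooth_leviCivita p q r)
  have hh := fun p q => P.diff hx (P.smooth_metric p q)
  have key : ∀ i j, pd i (pd j (fun y => metric f ξ y k l)) x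
      = ∑ m, pd i (leviCivita f ξ j k m) x * metric f ξ x m l
        + (∑ m, leviCivita f ξ j k m x * ∑ p, leviCivita f ξ i m p x * metric f ξ x p l
          + ∑ m, leviCivita f ξ j k m x * ∑ p, leviCivita f ξ i l p x * metric f ξ x p m)
        + (∑ m, pd i (leviCivita f ξ j l m) x * metric f ξ x m k
        + (∑ m, leviCivita f ξ j l m x * ∑ p, leviCivita f ξ i m p x * metric f ξ x p k
          + ∑ m, leviCivita f ξ j l m x * ∑ p, leviCivita f ξ i k p x * metric f ξ x p m)) := by
    intro i j
    have e : Set.EqOn (pd j fun y => metric f ξ y k l)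
      (fun y => ∑ m, leviCivita f ξ j k m y * metric f ξ y m l
        + ∑ m, leviCivita f ξ j l m y * metric f ξ y m k) U := fun y hy => P.pd_metric hy j k l
    rw [pd_congr P.isOpen e hx, pd_add
      (DifferentiableAt.fun_sum fun m _ => (hG j k m).fun_mul (hh m l))
      (DifferentiableAt.fun_sum fun m _ => (hG j l m).fun_mul (hh m k)),
      pd_sum_mul _ (hG j k) fun m => hh m l, pd_sum_mul _ (hG j l) fun m => hh m k]
    simp only [P.pd_metric hx, mul_add, Finset.sum_add_distrib]
  have h := pd_comm P.isOpen (P.smooth_metric k l) hx i j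
  rw [key, key] at h
  rw [sum_curvature_mul, sum_curvature_mul]
  have s : ∀ a b c d : Fin n,
      ∑ m, leviCivita f ξ a b m x * ∑ p, leviCivita f ξ c d p x * metric f ξ x p m
        = ∑ m, leviCivita f ξ c d m x * ∑ p, leviCivita f ξ a b p x * metric f ξ x p m := by
    intro a b c d
    rw [sum_mul_sum_mul_swap]
    simp only [P.metric_symm hx]
  rw [s j k i l, s j l i k] at h
  linarith

/-- If the cubic form vanishes, then the induced connection is the Levi-Civita connection. -/
theorem leviCivita_eq_of_cubicForm_eq_zero (P : IsBlaschkePatch f ξ U)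
    (hC : ∀ y ∈ U, ∀ i j k, cubicForm f ξ i j k y = 0) (hx : x ∈ U) (i j k : Fin n) :
    leviCivita f ξ i j k x = affineChristoffel f ξ i j k x := by
  have hp : ∀ i j k, pd i (fun y => metric f ξ y j k) x
      = ∑ l, affineChristoffel f ξ i j l x * metric f ξ x l k
        + ∑ l, affineChristoffel f ξ i k l x * metric f ξ x l j := by
    intro i j k
    have h := hC x hx i j k
    simp only [cubicForm, P.metric_symm hx j] at h
    linarith
  have hl : ∀ l, ∑ m, leviCivita f ξ i j m x * metric f ξ x m l
      = ∑ m, affineChristoffel f ξ i j m x * metric f ξ x m l := by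
    intro l
    rw [P.leviCivita_lower hx, hp, hp, hp]
    simp only [P.affineChristoffel_symm hx l, P.affineChristoffel_symm hx j i]
    ring
  have h2 : ∀ t : Fin n → ℝ,
      ∑ l, (∑ m, t m * metric f ξ x m l) * (metric f ξ x)⁻¹ l k = t k := by
    intro t
    rw [sum_sum_mul_mul t _ fun m l => metric f ξ x m l]
    simp [P.metric_mul_inv hx]
  rw [← h2 fun m => leviCivita f ξ i j m x, ← h2 fun m => affineChristoffel f ξ i j m x]
  simp only [hl]

/-- The Gauss equation when the cubic form vanishes. -/
theorem curvature_eq_of_cubicForm_eq_zero (P : IsBlaschkePatch f ξ U)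
    (hC : ∀ y ∈ U, ∀ i j k, cubicForm f ξ i j k y = 0) (hx : x ∈ U) (i j k l : Fin n) :
    curvature f ξ i j k l x
      = metric f ξ x i k * weingarten f ξ j l x - metric f ξ x j k * weingarten f ξ i l x := by
  have e : ∀ a b c, Set.EqOn (leviCivita f ξ a b c) (affineChristoffel f ξ a b c) U :=
    fun a b c y hy => P.leviCivita_eq_of_cubicForm_eq_zero hC hy a b c
  have h := (P.codazzi_aux hx i j k).1 l
  rw [curvature, pd_congr P.isOpen (e j k l) hx, pd_congr P.isOpen (e i k l) hx]
  simp only [Finset.sum_sub_distrib, e _ _ _ hx]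
  linarith

end IsBlaschkePatch

end CurvatureIdentities

/-- A tensor with the symmetries of a curvature tensor vanishes if its sectional values vanish. -/
theorem eq_zero_of_sectional_eq_zero {V : Type*} [AddCommGroup V] (T : V → V → V → V → ℝ)
    (add₁ : ∀ u u' v w z, T (u + u') v w z = T u v w z + T u' v w z)
    (add₃ : ∀ u v w w' z, T u v (w + w') z = T u v w z + T u v w' z)
    (antisymm : ∀ u v w z, T u v w z = -T v u w z)
    (antisymm' : ∀ u v w z, T u v w z = -T u v z w)
    (bianchi : ∀ u v w z, T u v w z + T v w u z + T w u v z = 0)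
    (h : ∀ u v, T u v v u = 0) (u v w z : V) : T u v w z = 0 := by
  -- The classical octahedron argument: pair symmetry is a combination of four Bianchi identities.
  have pair : ∀ u v w z, T u v w z = T w z u v := by
    intro u v w z
    linarith [bianchi u v w z, bianchi v w z u, bianchi w z u v, bianchi z u v w,
      antisymm u v w z, antisymm v w u z, antisymm w u v z, antisymm u v z w, antisymm v w z u,
      antisymm w u z v, antisymm w z u v, antisymm w z v u, antisymm z u v w, antisymm z u w v,
      antisymm z v u w, antisymm z v w u, antisymm' u v w z, antisymm' v w u z, antisymm' w u v z,
      antisymm' w z u v, antisymm' z u v w, antisymm' z v u w, antisymm' u w v z,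
      antisymm' v z w u, antisymm' v z u w, antisymm v z u w, antisymm v z w u]
  have add₂ : ∀ u v v' w z, T u (v + v') w z = T u v w z + T u v' w z := by
    intro u v v' w z
    rw [antisymm, add₁, antisymm v, antisymm v']; ring
  have add₄ : ∀ u v w z z', T u v w (z + z') = T u v w z + T u v w z' := by
    intro u v w z z'
    rw [antisymm', add₃, antisymm' u v z, antisymm' u v z']; ring
  -- Polarization in the outer slots, then in the inner ones, makes `T` antisymmetric in the middle
  -- pair as well. Cyclic shifts then fix `T`, and Bianchi reads `3 T = 0`.
  have h1 : ∀ u v z, T u v v z = 0 := by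
    intro u v z
    have e := h (u + z) v
    rw [add₁, add₄, add₄, h, h] at e
    have : T z v v u = T u v v z := by rw [pair, antisymm, antisymm']; ring
    linarith
  have h2 : ∀ u v w z, T u v w z = -T u w v z := by
    intro u v w z
    have e := h1 u (v + w) z
    rw [add₂, add₃, add₃, h1, h1] at e
    linarith
  linarith [bianchi u v w z, h2 u v w z, antisymm u w v z, h2 v w u z, antisymm v u w z]

/-! ### Constant sectional curvature and vanishing of a semi-parallel cubic form -/

section ConstantCurvature

variable {n : ℕ} {f ξ : EuclideanSpace ℝ (Fin n) → Fin (n + 1) → ℝ}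
  {U : Set (EuclideanSpace ℝ (Fin n))} {x : EuclideanSpace ℝ (Fin n)}

theorem metricApply_add_left (u u' v : Fin n → ℝ) :
    metricApply f ξ x (u + u') v = metricApply f ξ x u v + metricApply f ξ x u' v := by
  simp [metricApply, add_dotProduct]

theorem metricApply_add_right (u v v' : Fin n → ℝ) :
    metricApply f ξ x u (v + v') = metricApply f ξ x u v + metricApply f ξ x u v' := by
  simp [metricApply, Matrix.mulVec_add]

theorem metricApply_smul_left (t : ℝ) (u v : Fin n → ℝ) :
    metricApply f ξ x (t • u) v = t * metricApply f ξ x u v := by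
  simp [metricApply]

theorem metricApply_smul_right (t : ℝ) (u v : Fin n → ℝ) :
    metricApply f ξ x u (t • v) = t * metricApply f ξ x u v := by
  simp [metricApply, Matrix.mulVec_smul]

theorem metricApply_eq_sum (u v : Fin n → ℝ) :
    metricApply f ξ x u v = ∑ i, ∑ j, u i * v j * metric f ξ x i j := by
  simp only [metricApply, dotProduct, Matrix.mulVec, Finset.mul_sum]
  exact Finset.sum_congr rfl fun _ _ => Finset.sum_congr rfl fun _ _ => by ring

theorem curvatureApply_add₁ (u u' v w : Fin n → ℝ) :
    curvatureApply f ξ x (u + u') v w = curvatureApply f ξ x u v w + curvatureApply f ξ x u' v w := by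
  ext l
  simp [curvatureApply, add_mul, Finset.sum_add_distrib]

theorem curvatureApply_add₃ (u v w w' : Fin n → ℝ) :
    curvatureApply f ξ x u v (w + w') = curvatureApply f ξ x u v w + curvatureApply f ξ x u v w' := by
  ext l
  simp [curvatureApply, add_mul, mul_add, Finset.sum_add_distrib]

theorem curvatureApply_antisymm (u v w : Fin n → ℝ) :
    curvatureApply f ξ x u v w = -curvatureApply f ξ x v u w := by
  ext l
  simp only [curvatureApply, Pi.neg_apply, ← Finset.sum_neg_distrib]
  rw [Finset.sum_comm]
  refine Finset.sum_congr rfl fun j _ => Finset.sum_congr rfl fun i _ =>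
    Finset.sum_congr rfl fun k _ => ?_
  rw [IsBlaschkePatch.curvature_antisymm]; ring

theorem curvatureApply_single (i j k l : Fin n) :
    curvatureApply f ξ x (Pi.single i 1) (Pi.single j 1) (Pi.single k 1) l
      = curvature f ξ i j k l x := by
  simp [curvatureApply, Pi.single_apply]

/-- The component expansion reduces symmetries to those of the lowered curvature components and
exhibits continuity in the vectors. -/
theorem metricApply_curvatureApply (u v w z : Fin n → ℝ) :
    metricApply f ξ x (curvatureApply f ξ x u v w) z
      = ∑ i, ∑ j, ∑ k, ∑ m, u i * v j * w k * z m
          * ∑ l, curvature f ξ i j k l x * metric f ξ x l m := by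
  rw [metricApply_eq_sum]
  simp only [curvatureApply, Finset.sum_mul, Finset.mul_sum]
  have c : ∀ F : Fin n → Fin n → Fin n → Fin n → Fin n → ℝ,
      ∑ l, ∑ m, ∑ i, ∑ j, ∑ k, F i j k m l = ∑ i, ∑ j, ∑ k, ∑ m, ∑ l, F i j k m l := by
    intro F
    rw [Finset.sum_comm]
    simp only [Finset.sum_comm (s := (Finset.univ : Finset (Fin n)))
      (t := (Finset.univ : Finset (Fin n))) (f := fun l i => ∑ j, ∑ k, F i j k _ l)]
    rw [Finset.sum_comm]
    refine Finset.sum_congr rfl fun i _ => ?_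
    have : ∀ m, ∑ l, ∑ j, ∑ k, F i j k m l = ∑ j, ∑ k, ∑ l, F i j k m l := by
      intro m
      rw [Finset.sum_comm]
      exact Finset.sum_congr rfl fun j _ => Finset.sum_comm
    simp only [this]
    rw [Finset.sum_comm]
    exact Finset.sum_congr rfl fun j _ => Finset.sum_comm
  rw [c fun i j k m l => u i * v j * w k * curvature f ξ i j k l x * z m * metric f ξ x l m]
  refine Finset.sum_congr rfl fun i _ => Finset.sum_congr rfl fun j _ =>
    Finset.sum_congr rfl fun k _ => Finset.sum_congr rfl fun m _ =>
    Finset.sum_congr rfl fun l _ => by ring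

theorem continuous_metricApply_line (u u' v v' : Fin n → ℝ) :
    Continuous fun t : ℝ => metricApply f ξ x (u + t • u') (v + t • v') := by
  simp only [metricApply_eq_sum, Pi.add_apply, Pi.smul_apply, smul_eq_mul]
  fun_prop

theorem continuous_curvature_line (u u' v v' : Fin n → ℝ) :
    Continuous fun t : ℝ => metricApply f ξ x
      (curvatureApply f ξ x (u + t • u') (v + t • v') (v + t • v')) (u + t • u') := by
  simp only [metricApply_curvatureApply, Pi.add_apply, Pi.smul_apply, smul_eq_mul]
  fun_prop

/-- Along the line the area form is a polynomial in `t` whose coefficient of `t ^ 4` is `areaForm f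
ξ x u' v'`, so it has finitely many zeros. Thus pairs spanning non-degenerate planes accumulate at
every pair `(u, v)`. -/
theorem eventually_areaForm_ne_zero {u' v' : Fin n → ℝ} (h : areaForm f ξ x u' v' ≠ 0) (u v : Fin n → ℝ) :
    ∀ᶠ t : ℝ in nhdsWithin 0 {0}ᶜ, areaForm f ξ x (u + t • u') (v + t • v') ≠ 0 := by
  have e : ∃ p : Polynomial ℝ, p ≠ 0 ∧
      ∀ t, areaForm f ξ x (u + t • u') (v + t • v') = p.eval t := by
    set g := metricApply f ξ x
    let q : (Fin n → ℝ) → (Fin n → ℝ) → (Fin n → ℝ) → (Fin n → ℝ) → Polynomial ℝ :=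
      fun u u' v v' => .C (g u' v') * .X ^ 2 + .C (g u v' + g u' v) * .X + .C (g u v)
    have hq : ∀ u u' v v' t, g (u + t • u') (v + t • v') = (q u u' v v').eval t := by
      intro u u' v v' t
      simp only [q, g, metricApply_add_left, metricApply_add_right, metricApply_smul_left,
        metricApply_smul_right, Polynomial.eval_add, Polynomial.eval_mul, Polynomial.eval_C,
        Polynomial.eval_pow, Polynomial.eval_X]
      ring
    refine ⟨q u u' u u' * q v v' v v' - q u u' v v' ^ 2, fun h0 => h ?_, fun t => ?_⟩
    · have hc : ∀ a b c a' b' c' : ℝ, ((.C a * .X ^ 2 + .C b * .X + .C c) *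
          (.C a' * .X ^ 2 + .C b' * .X + .C c') : Polynomial ℝ).coeff 4 = a * a' := by
        intro a b c a' b' c'
        have : ((.C a * .X ^ 2 + .C b * .X + .C c) *
          (.C a' * .X ^ 2 + .C b' * .X + .C c') : Polynomial ℝ) = .C (a * a') * .X ^ 4
            + .C (a * b' + b * a') * .X ^ 3 + .C (a * c' + b * b' + c * a') * .X ^ 2
            + .C (b * c' + c * b') * .X + .C (c * c') := by
          simp only [map_add, map_mul]; ring
        rw [this]
        simp only [Polynomial.coeff_add, Polynomial.coeff_C_mul, Polynomial.coeff_X_pow,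
          Polynomial.coeff_X, Polynomial.coeff_C]
        norm_num
      have := congrArg (Polynomial.coeff · 4) h0
      simp only [sq (q u u' v v'), Polynomial.coeff_sub, Polynomial.coeff_zero] at this
      rw [hc, hc] at this
      rw [areaForm, sq]
      exact this
    · simp only [areaForm, Polynomial.eval_sub, Polynomial.eval_mul, Polynomial.eval_pow, ← hq, g]
  obtain ⟨p, hp, hpe⟩ := e
  have hfin : (({t | p.IsRoot t} : Set ℝ) \ {0}).Finite :=
    (Polynomial.finite_setOfPred_isRoot hp).subset Set.sdiff_subset
  have hn : (({t | p.IsRoot t} : Set ℝ) \ {0})ᶜ ∈ nhds (0 : ℝ) :=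
    hfin.isClosed.isOpen_compl.mem_nhds (by simp)
  filter_upwards [self_mem_nhdsWithin, mem_nhdsWithin_of_mem_nhds hn] with t ht0 ht
  rw [hpe]
  intro h
  exact ht ⟨h, ht0⟩

namespace IsBlaschkePatch

theorem metricApply_symm (P : IsBlaschkePatch f ξ U) (hx : x ∈ U) (u v : Fin n → ℝ) :
    metricApply f ξ x u v = metricApply f ξ x v u := by
  rw [metricApply_eq_sum, metricApply_eq_sum, Finset.sum_comm]
  refine Finset.sum_congr rfl fun i _ => Finset.sum_congr rfl fun j _ => ?_
  rw [P.metric_symm hx j i]; ring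

theorem eq_zero_of_metricApply (P : IsBlaschkePatch f ξ U) (hx : x ∈ U) {u : Fin n → ℝ}
    (h : ∀ v, metricApply f ξ x u v = 0) : u = 0 := by
  by_contra hu
  refine P.det_metric x hx (Matrix.exists_vecMul_eq_zero_iff.1 ⟨u, hu, ?_⟩)
  refine dotProduct_eq_zero _ fun v => ?_
  rw [← Matrix.dotProduct_mulVec]
  exact h v

theorem curvatureApply_antisymm_right (P : IsBlaschkePatch f ξ U) (hx : x ∈ U)
    (u v w z : Fin n → ℝ) :
    metricApply f ξ x (curvatureApply f ξ x u v w) z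
      = -metricApply f ξ x (curvatureApply f ξ x u v z) w := by
  simp only [metricApply_curvatureApply, ← Finset.sum_neg_distrib]
  refine Finset.sum_congr rfl fun i _ => Finset.sum_congr rfl fun j _ => ?_
  rw [Finset.sum_comm]
  refine Finset.sum_congr rfl fun m _ => Finset.sum_congr rfl fun k _ => ?_
  rw [eq_neg_of_add_eq_zero_left (P.curvature_lower_antisymm hx i j k m)]
  ring

theorem curvatureApply_bianchi (P : IsBlaschkePatch f ξ U) (hx : x ∈ U) (u v w : Fin n → ℝ) :
    curvatureApply f ξ x u v w + curvatureApply f ξ x v w u + curvatureApply f ξ x w u v = 0 := by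
  ext l
  simp only [curvatureApply, Pi.add_apply, Pi.zero_apply]
  have c1 : ∑ i, ∑ j, ∑ k, v i * w j * u k * curvature f ξ i j k l x
      = ∑ i, ∑ j, ∑ k, v j * w k * u i * curvature f ξ j k i l x := by
    simp only [Finset.sum_comm (s := (Finset.univ : Finset (Fin n)))
      (f := fun j k => v _ * w j * u k * curvature f ξ _ j k l x)]
    rw [Finset.sum_comm]
  have c2 : ∑ i, ∑ j, ∑ k, w i * u j * v k * curvature f ξ i j k l x
      = ∑ i, ∑ j, ∑ k, w k * u i * v j * curvature f ξ k i j l x := by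
    rw [Finset.sum_comm]
    exact Finset.sum_congr rfl fun i _ => Finset.sum_comm
  rw [c1, c2]
  simp only [← Finset.sum_add_distrib]
  refine Finset.sum_eq_zero fun i _ => Finset.sum_eq_zero fun j _ => Finset.sum_eq_zero fun k _ => ?_
  linear_combination u i * v j * w k * P.curvature_bianchi hx i j k l

/-- Polarization gives `u` with `h(u, u) ≠ 0`, and `n ≥ 2` gives `v ≠ 0` orthogonal to `u`. If every
area form vanished, comparing the pairs `(u, v)`, `(u, w)` and `(u, v + w)` would put `v` in the
radical of `h`. -/
theorem exists_areaForm_ne_zero (P : IsBlaschkePatch f ξ U) (hn : 2 ≤ n) (hx : x ∈ U) :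
    ∃ u v, areaForm f ξ x u v ≠ 0 := by
  by_contra! H
  simp only [areaForm] at H
  obtain ⟨u, hu⟩ : ∃ u, metricApply f ξ x u u ≠ 0 := by
    by_contra! h0
    have : (Pi.single ⟨0, by omega⟩ 1 : Fin n → ℝ) = 0 := P.eq_zero_of_metricApply hx fun v => by
      have := h0 (Pi.single ⟨0, by omega⟩ 1 + v)
      rw [metricApply_add_left, metricApply_add_right, metricApply_add_right, h0, h0,
        P.metricApply_symm hx v] at this
      linarith
    simpa using congrFun this ⟨0, by omega⟩
  obtain ⟨v, hv, hv0⟩ : ∃ v, metricApply f ξ x u v = 0 ∧ v ≠ 0 := by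
    set φ := u ᵥ* metric f ξ x with hφ
    have hm : ∀ v, metricApply f ξ x u v = φ ⬝ᵥ v := fun v => by
      rw [metricApply, Matrix.dotProduct_mulVec]
    set a : Fin n := ⟨0, by omega⟩ with ha
    set b : Fin n := ⟨1, by omega⟩ with hb
    have hab : a ≠ b := by simp [ha, hb]
    by_cases h0 : φ a = 0
    · exact ⟨Pi.single a 1, by simp [hm, h0], by simp⟩
    · refine ⟨φ b • Pi.single a 1 - φ a • Pi.single b 1, by simp [hm, mul_comm], fun e => h0 ?_⟩
      simpa [hab.symm] using congrFun e b
  refine hv0 (P.eq_zero_of_metricApply hx fun w => ?_)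
  have h1 := H u v
  have h2 := H u (v + w)
  have h3 := H u w
  simp only [metricApply_add_left, metricApply_add_right, hv, P.metricApply_symm hx w v] at h1 h2
  have : metricApply f ξ x u u * metricApply f ξ x v w = 0 := by linarith
  exact (mul_eq_zero.1 this).resolve_left hu

/-- The difference `T` between the curvature and the constant-curvature model has zero sectional
values on non-degenerate planes, hence on all pairs by continuity. Algebraic curvature tensors are
determined by these values. -/
theorem curvature_eq_of_sectionalCurvature_eq (P : IsBlaschkePatch f ξ U) (hn : 2 ≤ n)
    (hx : x ∈ U) {κ : ℝ}
    (hκ : ∀ u v, areaForm f ξ x u v ≠ 0 → sectionalCurvature f ξ x u v = κ) (i j k l : Fin n) :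
    curvature f ξ i j k l x = κ * (metric f ξ x j k * (if i = l then 1 else 0)
      - metric f ξ x i k * (if j = l then 1 else 0)) := by
  set g := metricApply f ξ x with hg
  let T : (Fin n → ℝ) → (Fin n → ℝ) → (Fin n → ℝ) → (Fin n → ℝ) → ℝ := fun u v w z =>
    g (curvatureApply f ξ x u v w) z - κ * (g v w * g u z - g u w * g v z)
  have hsec : ∀ u v, T u v v u = 0 := by
    intro u v
    obtain ⟨u', v', h'⟩ := P.exists_areaForm_ne_zero hn hx
    have hc : Continuous fun t : ℝ => T (u + t • u') (v + t • v') (v + t • v') (u + t • u') := by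
      have h1 := continuous_metricApply_line (f := f) (ξ := ξ) (x := x) u u' v v'
      have h2 := continuous_metricApply_line (f := f) (ξ := ξ) (x := x) u u' u u'
      have h3 := continuous_metricApply_line (f := f) (ξ := ξ) (x := x) v v' v v'
      have h4 := continuous_metricApply_line (f := f) (ξ := ξ) (x := x) v v' u u'
      exact (continuous_curvature_line u u' v v').sub
        (continuous_const.mul ((h3.mul h2).sub (h1.mul h4)))
    have hz : ∀ᶠ t : ℝ in nhdsWithin 0 {0}ᶜ,
        T (u + t • u') (v + t • v') (v + t • v') (u + t • u') = 0 := by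
      filter_upwards [eventually_areaForm_ne_zero h' u v] with t ht
      have := hκ _ _ ht
      rw [sectionalCurvature, div_eq_iff ht, areaForm] at this
      simp only [T, hg, this]
      rw [P.metricApply_symm hx (v + t • v') (u + t • u')]
      ring
    have h0 := (hc.tendsto 0).mono_left (nhdsWithin_le_nhds (s := {0}ᶜ))
    have := tendsto_nhds_unique (h0.congr' hz) tendsto_const_nhds
    simpa using this
  have hT : ∀ u v w z, T u v w z = 0 := by
    refine eq_zero_of_sectional_eq_zero T ?_ ?_ ?_ ?_ ?_ hsec
    · intro u u' v w z
      simp only [T, hg, curvatureApply_add₁, metricApply_add_left]; ring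
    · intro u v w w' z
      simp only [T, hg, curvatureApply_add₃, metricApply_add_left, metricApply_add_right]; ring
    · intro u v w z
      simp only [T]
      have : g (curvatureApply f ξ x u v w) z = -g (curvatureApply f ξ x v u w) z := by
        rw [curvatureApply_antisymm]; simp [hg, metricApply]
      rw [this]; ring
    · intro u v w z
      simp only [T, hg, P.curvatureApply_antisymm_right hx u v w z]; ring
    · intro u v w z
      have := congrArg (fun a => g a z) (P.curvatureApply_bianchi hx u v w)
      simp only [hg, metricApply_add_left] at this
      have z0 : metricApply f ξ x 0 z = 0 := by simp [metricApply]
      simp only [T, hg] at this ⊢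
      rw [z0] at this
      rw [P.metricApply_symm hx w u, P.metricApply_symm hx w v, P.metricApply_symm hx v u]
      linear_combination this
  have hs : ∀ a b, g (Pi.single a 1) (Pi.single b 1) = metric f ξ x a b := by
    intro a b
    simp [hg, metricApply]
  have hv : curvatureApply f ξ x (Pi.single i 1) (Pi.single j 1) (Pi.single k 1)
      + (-(κ * metric f ξ x j k)) • Pi.single i 1 + (κ * metric f ξ x i k) • Pi.single j 1 = 0 := by
    refine P.eq_zero_of_metricApply hx fun z => ?_
    have := hT (Pi.single i 1) (Pi.single j 1) (Pi.single k 1) z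
    simp only [T, hs] at this
    rw [metricApply_add_left, metricApply_add_left, metricApply_smul_left, metricApply_smul_left,
      ← hg]
    linear_combination this
  have := congrFun hv l
  simp only [Pi.add_apply, Pi.smul_apply, Pi.zero_apply, curvatureApply_single, smul_eq_mul,
    Pi.single_apply, eq_comm (a := l)] at this
  linear_combination this

/-- In constant curvature `κ ≠ 0`, a semi-parallel cubic form vanishes. -/
theorem cubicForm_eq_zero_of_semiParallel (P : IsBlaschkePatch f ξ U) (hx : x ∈ U) {κ : ℝ}
    (hκ : κ ≠ 0)
    (hR : ∀ i j k l, curvature f ξ i j k l x = κ * (metric f ξ x j k * (if i = l then 1 else 0)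
      - metric f ξ x i k * (if j = l then 1 else 0)))
    (hC : ∀ i j a b c, curvatureDotCubic f ξ i j a b c x = 0) (i b c : Fin n) :
    cubicForm f ξ i b c x = 0 := by
  have h : ∀ j a, metric f ξ x j a * cubicForm f ξ i b c x - metric f ξ x i a * cubicForm f ξ j b c x
      + (metric f ξ x j b * cubicForm f ξ a i c x - metric f ξ x i b * cubicForm f ξ a j c x)
      + (metric f ξ x j c * cubicForm f ξ a b i x - metric f ξ x i c * cubicForm f ξ a b j x) = 0 := by
    intro j a
    have := hC i j a b c
    rw [P.curvatureDotCubic_eq hx] at this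
    simp only [hR, mul_assoc, sub_mul, ite_mul, one_mul, zero_mul, mul_ite, mul_zero,
      Finset.sum_sub_distrib, mul_sub, Finset.sum_ite_eq, Finset.mem_univ, if_true] at this
    refine (mul_eq_zero.1 (?_ : κ * _ = 0)).resolve_left hκ
    linear_combination -this
  -- Contract the identity `h` in `a` and `j`. By `t1`, `t2` and `t3`, with the symmetry of `C`, the
  -- terms contribute `n - 1 + 1 + 1` copies of `C_ibc`; the other two vanish by apolarity (`t4`).
  have hs : ∑ a, ∑ j, (metric f ξ x)⁻¹ a j *
      (metric f ξ x j a * cubicForm f ξ i b c x - metric f ξ x i a * cubicForm f ξ j b c x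
      + (metric f ξ x j b * cubicForm f ξ a i c x - metric f ξ x i b * cubicForm f ξ a j c x)
      + (metric f ξ x j c * cubicForm f ξ a b i x - metric f ξ x i c * cubicForm f ξ a b j x)) = 0 :=
    Finset.sum_eq_zero fun a _ => Finset.sum_eq_zero fun j _ => by rw [h, mul_zero]
  have t1 : ∀ t : ℝ, ∑ a, ∑ j, (metric f ξ x)⁻¹ a j * (metric f ξ x j a * t) = n * t := by
    intro t
    simp only [← mul_assoc, ← Finset.sum_mul, P.inv_metric_mul hx]
    simp
  have t2 : ∑ a, ∑ j, (metric f ξ x)⁻¹ a j * (metric f ξ x i a * cubicForm f ξ j b c x)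
      = cubicForm f ξ i b c x := by
    rw [Finset.sum_comm]
    have : ∀ j, ∑ a, (metric f ξ x)⁻¹ a j * (metric f ξ x i a * cubicForm f ξ j b c x)
        = (∑ a, metric f ξ x i a * (metric f ξ x)⁻¹ a j) * cubicForm f ξ j b c x := by
      intro j
      rw [Finset.sum_mul]
      exact Finset.sum_congr rfl fun a _ => by ring
    simp [this, P.metric_mul_inv hx]
  have t3 : ∀ (b : Fin n) (t : Fin n → ℝ),
      ∑ a, ∑ j, (metric f ξ x)⁻¹ a j * (metric f ξ x j b * t a) = t b := by
    intro b t
    simp only [← mul_assoc, ← Finset.sum_mul, P.inv_metric_mul hx]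
    simp
  have t4 : ∀ (s : ℝ) (d : Fin n),
      ∑ a, ∑ j, (metric f ξ x)⁻¹ a j * (s * cubicForm f ξ a j d x) = 0 := by
    intro s d
    have := P.apolarity hx d
    have e : ∀ a j, cubicForm f ξ a j d x = cubicForm f ξ d j a x := by
      intro a j
      rw [P.cubicForm_symm_right hx, P.cubicForm_symm_left hx, P.cubicForm_symm_right hx]
    simp only [e, mul_left_comm _ s, ← Finset.mul_sum, this, mul_zero]
  have e1 : ∀ a, cubicForm f ξ a i c x = cubicForm f ξ i a c x := fun a =>
    P.cubicForm_symm_left hx a i c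
  have e2 : cubicForm f ξ c b i x = cubicForm f ξ i b c x := by
    rw [P.cubicForm_symm_right hx, P.cubicForm_symm_left hx, P.cubicForm_symm_right hx]
  have e3 : ∀ a j, cubicForm f ξ a b j x = cubicForm f ξ a j b x := fun a j =>
    P.cubicForm_symm_right hx a b j
  have t5 := t4 (metric f ξ x i c) b
  simp only [mul_add, mul_sub, Finset.sum_add_distrib, Finset.sum_sub_distrib] at hs
  rw [t1, t2, t3 b fun a => cubicForm f ξ a i c x, t3 c fun a => cubicForm f ξ a b i x,
    t4, e1, e2] at hs
  simp only [e3, t5] at hs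
  have hn : ((n : ℝ) + 1) * cubicForm f ξ i b c x = 0 := by
    rw [e3 i c] at *
    linear_combination hs
  exact (mul_eq_zero.1 hn).resolve_left (by positivity)

end IsBlaschkePatch

end ConstantCurvature

/-! ### Affine invariants of a piece of a hyperquadric, and rigidity when the cubic form vanishes -/

section Hyperquadric

variable {n : ℕ} {ι : Type*} [Fintype ι] {U : Set (EuclideanSpace ℝ (Fin n))}
  {x : EuclideanSpace ℝ (Fin n)}

theorem pd_dotProduct {u v : EuclideanSpace ℝ (Fin n) → ι → ℝ} (hu : DifferentiableAt ℝ u x)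
    (hv : DifferentiableAt ℝ v x) (i : Fin n) :
    pd i (fun y => u y ⬝ᵥ v y) x = pd i u x ⬝ᵥ v x + u x ⬝ᵥ pd i v x := by
  simp only [dotProduct]
  rw [pd_sum_mul _ (fun r => differentiableAt_pi.1 hu r) (fun r => differentiableAt_pi.1 hv r),
    Finset.sum_add_distrib]
  simp only [pd_apply hu, pd_apply hv]

theorem differentiableAt_dotProduct {u v : EuclideanSpace ℝ (Fin n) → ι → ℝ}
    (hu : DifferentiableAt ℝ u x) (hv : DifferentiableAt ℝ v x) :
    DifferentiableAt ℝ (fun y => u y ⬝ᵥ v y) x := by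
  simp only [dotProduct]
  exact DifferentiableAt.fun_sum fun r _ =>
    (differentiableAt_pi.1 hu r).fun_mul (differentiableAt_pi.1 hv r)

theorem differentiableAt_mulVec {A : EuclideanSpace ℝ (Fin n) → Matrix ι ι ℝ}
    (hA : ∀ r s, DifferentiableAt ℝ (fun y => A y r s) x)
    {v : EuclideanSpace ℝ (Fin n) → ι → ℝ} (hv : DifferentiableAt ℝ v x) :
    DifferentiableAt ℝ (fun y => A y *ᵥ v y) x :=
  differentiableAt_pi.2 fun r =>
    differentiableAt_dotProduct (differentiableAt_pi.2 fun s => hA r s) hv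

theorem pd_dotProduct_mulVec {A : EuclideanSpace ℝ (Fin n) → Matrix ι ι ℝ}
    (hA : ∀ r s, DifferentiableAt ℝ (fun y => A y r s) x)
    {u v : EuclideanSpace ℝ (Fin n) → ι → ℝ} (hu : DifferentiableAt ℝ u x)
    (hv : DifferentiableAt ℝ v x) (i : Fin n) :
    pd i (fun y => u y ⬝ᵥ A y *ᵥ v y) x = pd i u x ⬝ᵥ A x *ᵥ v x
      + u x ⬝ᵥ (Matrix.of fun r s => pd i (fun y => A y r s) x) *ᵥ v x
      + u x ⬝ᵥ A x *ᵥ pd i v x := by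
  have hAv := differentiableAt_mulVec hA hv
  rw [pd_dotProduct hu hAv, add_assoc, ← dotProduct_add]
  congr 2
  ext r
  have hAr : DifferentiableAt ℝ (fun y => A y r) x := differentiableAt_pi.2 fun s => hA r s
  rw [← pd_apply hAv]
  refine (pd_dotProduct hAr hv i).trans ?_
  simp only [Pi.add_apply, Matrix.mulVec]
  congr 2
  ext s
  exact (pd_apply hAr i s).symm

theorem pd_dotProduct_const_mulVec (A : Matrix ι ι ℝ)
    {u v : EuclideanSpace ℝ (Fin n) → ι → ℝ} (hu : DifferentiableAt ℝ u x)
    (hv : DifferentiableAt ℝ v x) (i : Fin n) :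
    pd i (fun y => u y ⬝ᵥ A *ᵥ v y) x = pd i u x ⬝ᵥ A *ᵥ v x + u x ⬝ᵥ A *ᵥ pd i v x := by
  rw [pd_dotProduct_mulVec (A := fun _ => A) (fun _ _ => differentiableAt_const _) hu hv]
  have : (Matrix.of fun r s => pd i (fun _ => A r s) x) = 0 := by
    ext r s; exact pd_const i _
  rw [this]; simp

theorem dotProduct_mulVec_symm {A : Matrix ι ι ℝ} (hA : A.IsSymm) (u v : ι → ℝ) :
    u ⬝ᵥ A *ᵥ v = v ⬝ᵥ A *ᵥ u := by
  conv_lhs => rw [← hA.eq, Matrix.mulVec_transpose, dotProduct_comm, ← Matrix.dotProduct_mulVec]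

variable {f ξ : EuclideanSpace ℝ (Fin n) → Fin (n + 1) → ℝ}

/-- The extended matrix of a hyperquadric is singular at a point whose gradient vanishes. -/
theorem det_extended_eq_zero {m : ℕ} (A : Matrix (Fin m) (Fin m) ℝ) (b : Fin m → ℝ) (d : ℝ)
    (p : Fin m → ℝ) (hp : A *ᵥ p + b = 0) (hq : p ⬝ᵥ A *ᵥ p + 2 * (b ⬝ᵥ p) + d = 0) :
    (Matrix.fromBlocks A (Matrix.replicateCol Unit b) (Matrix.replicateRow Unit b)
      (Matrix.of fun _ _ : Unit => d)).det = 0 := by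
  refine Matrix.exists_mulVec_eq_zero_iff.1 ⟨Sum.elim p fun _ => 1, fun h => ?_, ?_⟩
  · simpa using congrFun h (Sum.inr ())
  · have h1 : b ⬝ᵥ p + d = 0 := by
      have : p ⬝ᵥ (A *ᵥ p + b) = 0 := by rw [hp]; simp
      rw [dotProduct_add, dotProduct_comm p b] at this
      linarith
    rw [Matrix.fromBlocks_mulVec]
    ext r
    rcases r with r | r
    · simpa [Matrix.mulVec, dotProduct, Matrix.replicateCol] using congrFun hp r
    · simpa [Matrix.mulVec, dotProduct, Matrix.replicateRow] using h1

namespace IsBlaschkePatch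

theorem mono (P : IsBlaschkePatch f ξ U) {U' : Set (EuclideanSpace ℝ (Fin n))} (hU' : IsOpen U')
    (h : U' ⊆ U) : IsBlaschkePatch f ξ U' where
  isOpen := hU'
  smooth := P.smooth.mono h
  smooth_normal := P.smooth_normal.mono h
  det_frame x hx := P.det_frame x (h hx)
  tangent x hx := P.tangent x (h hx)
  det_metric x hx := P.det_metric x (h hx)
  volume x hx := P.volume x (h hx)

theorem exists_frame_coeff (P : IsBlaschkePatch f ξ U) (hx : x ∈ U) (v : Fin (n + 1) → ℝ) :
    ∃ (w : Fin n → ℝ) (t : ℝ), v = ∑ k, w k • pd k f x + t • ξ x :=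
  ⟨_, _, by rw [← frame_mulVec, P.frame_mulVec_inv hx]⟩

theorem eq_zero_of_metric (P : IsBlaschkePatch f ξ U) (hx : x ∈ U) {w : Fin n → ℝ}
    (h : ∀ i, ∑ k, w k * metric f ξ x k i = 0) : w = 0 := by
  by_contra hw
  exact P.det_metric x hx (Matrix.exists_vecMul_eq_zero_iff.1 ⟨w, hw, funext h⟩)

theorem dotProduct_pd_normal (P : IsBlaschkePatch f ξ U) (hx : x ∈ U) (i : Fin n)
    (v : Fin (n + 1) → ℝ) :
    v ⬝ᵥ pd i ξ x = ∑ k, weingarten f ξ i k x * (v ⬝ᵥ pd k f x) := by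
  simp [P.pd_normal hx, dotProduct_sum]

theorem dotProduct_pd_pd (P : IsBlaschkePatch f ξ U) (hx : x ∈ U) (i j : Fin n)
    (v : Fin (n + 1) → ℝ) :
    v ⬝ᵥ pd i (pd j f) x = ∑ k, affineChristoffel f ξ i j k x * (v ⬝ᵥ pd k f x)
      + metric f ξ x i j * (v ⬝ᵥ ξ x) := by
  simp [P.gauss hx, dotProduct_sum, dotProduct_add]

section

variable {A : Matrix (Fin (n + 1)) (Fin (n + 1)) ℝ} {b : Fin (n + 1) → ℝ} {d : ℝ}

theorem gradient_tangent (P : IsBlaschkePatch f ξ U) (hA : A.IsSymm)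
    (hQ : ∀ y ∈ U, f y ⬝ᵥ A *ᵥ f y + 2 * (b ⬝ᵥ f y) + d = 0) (hx : x ∈ U) (i : Fin n) :
    (A *ᵥ f x + b) ⬝ᵥ pd i f x = 0 := by
  have hf := P.diff hx P.smooth
  have hb : DifferentiableAt ℝ (fun _ : EuclideanSpace ℝ (Fin n) => b) x := differentiableAt_const _
  have h1 := differentiableAt_dotProduct hf (differentiableAt_mulVec (A := fun _ => A)
    (fun _ _ => differentiableAt_const _) hf)
  have h2 := (differentiableAt_const (2 : ℝ)).fun_mul (differentiableAt_dotProduct hb hf)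
  have h := pd_congr P.isOpen (g' := fun _ => (0 : ℝ)) (fun y hy => hQ y hy) hx i
  rw [pd_const, pd_add (h1.fun_add h2) (differentiableAt_const d), pd_const, pd_add h1 h2,
    pd_dotProduct_const_mulVec A hf hf, pd_mul (differentiableAt_const _)
    (differentiableAt_dotProduct hb hf), pd_const, pd_dotProduct hb hf, pd_const,
    dotProduct_mulVec_symm hA (f x), zero_dotProduct] at h
  rw [add_dotProduct, dotProduct_comm (A *ᵥ f x)]
  linarith

theorem differentiableAt_gradient (P : IsBlaschkePatch f ξ U) (hx : x ∈ U) :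
    DifferentiableAt ℝ (fun y => A *ᵥ f y + b) x :=
  (differentiableAt_mulVec (A := fun _ => A) (fun _ _ => differentiableAt_const _)
    (P.diff hx P.smooth)).fun_add (differentiableAt_const b)

theorem pd_gradient (P : IsBlaschkePatch f ξ U) (hx : x ∈ U) (i : Fin n) :
    pd i (fun y => A *ᵥ f y + b) x = A *ᵥ pd i f x := by
  have hf := P.diff hx P.smooth
  have hm : DifferentiableAt ℝ (fun y => A *ᵥ f y) x :=
    differentiableAt_mulVec (A := fun _ => A) (fun _ _ => differentiableAt_const _) hf
  rw [pd_add hm (differentiableAt_const b), pd_const, add_zero]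
  ext r
  rw [← pd_apply hm]
  refine (pd_dotProduct (u := fun _ => A r) (differentiableAt_const _) hf i).trans ?_
  rw [pd_const, zero_dotProduct, zero_add]
  rfl

/-- Differentiate `(A f + b) ⬝ ∂_j f = 0`. In the Gauss formula for `∂_i ∂_j f` only the `ξ`-part
pairs nontrivially with the gradient. -/
theorem form_tangent (P : IsBlaschkePatch f ξ U) (hA : A.IsSymm)
    (hQ : ∀ y ∈ U, f y ⬝ᵥ A *ᵥ f y + 2 * (b ⬝ᵥ f y) + d = 0) (hx : x ∈ U) (i j : Fin n) :
    pd i f x ⬝ᵥ A *ᵥ pd j f x = -(metric f ξ x i j * ((A *ᵥ f x + b) ⬝ᵥ ξ x)) := by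
  have h := pd_congr P.isOpen (g' := fun _ => (0 : ℝ))
    (fun y hy => P.gradient_tangent hA hQ hy j) hx i
  rw [pd_const, pd_dotProduct (P.differentiableAt_gradient hx)
    (P.diff hx (contDiffOn_pd P.isOpen P.smooth j)), P.pd_gradient hx,
    P.dotProduct_pd_pd hx] at h
  simp only [P.gradient_tangent hA hQ hx, mul_zero, Finset.sum_const_zero, zero_add] at h
  rw [dotProduct_mulVec_symm hA, dotProduct_comm]
  linarith

theorem pd_gradient_normal (P : IsBlaschkePatch f ξ U) (hA : A.IsSymm)
    (hQ : ∀ y ∈ U, f y ⬝ᵥ A *ᵥ f y + 2 * (b ⬝ᵥ f y) + d = 0) (hx : x ∈ U) (k : Fin n) :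
    pd k (fun y => (A *ᵥ f y + b) ⬝ᵥ ξ y) x = ξ x ⬝ᵥ A *ᵥ pd k f x := by
  rw [pd_dotProduct (P.differentiableAt_gradient hx) (P.diff hx P.smooth_normal),
    P.pd_gradient hx, P.dotProduct_pd_normal hx]
  simp [P.gradient_tangent hA hQ hx, dotProduct_comm]

/-- Differentiate the identity of `form_tangent`: the terms with `Γ` combine with the derivative of
`h` into `C`, and the rest is the symmetrized product of `h` with `ξᵀ A ∂_k f`. -/
theorem gradient_normal_mul_cubicForm (P : IsBlaschkePatch f ξ U) (hA : A.IsSymm)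
    (hQ : ∀ y ∈ U, f y ⬝ᵥ A *ᵥ f y + 2 * (b ⬝ᵥ f y) + d = 0) (hx : x ∈ U) (k i j : Fin n) :
    ((A *ᵥ f x + b) ⬝ᵥ ξ x) * cubicForm f ξ k i j x
      = -(metric f ξ x i j * (ξ x ⬝ᵥ A *ᵥ pd k f x) + metric f ξ x k i * (ξ x ⬝ᵥ A *ᵥ pd j f x)
        + metric f ξ x k j * (ξ x ⬝ᵥ A *ᵥ pd i f x)) := by
  have hf := fun i => P.diff hx (contDiffOn_pd P.isOpen P.smooth i)
  have hh := P.diff hx (P.smooth_metric i j)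
  have hφ := differentiableAt_dotProduct (P.differentiableAt_gradient (A := A) (b := b) hx)
    (P.diff hx P.smooth_normal)
  have h := pd_congr P.isOpen (g := fun y => pd i f y ⬝ᵥ A *ᵥ pd j f y)
    (g' := fun y => (-1 : ℝ) • (metric f ξ y i j * ((A *ᵥ f y + b) ⬝ᵥ ξ y)))
    (fun y hy => by simpa using P.form_tangent hA hQ hy i j) hx k
  rw [pd_dotProduct_const_mulVec A (hf i) (hf j), pd_const_smul (hh.fun_mul hφ), pd_mul hh hφ,
    P.pd_gradient_normal hA hQ hx, dotProduct_comm (pd k (pd i f) x), P.dotProduct_pd_pd hx,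
    dotProduct_mulVec_symm hA (pd i f x), dotProduct_comm (pd k (pd j f) x),
    P.dotProduct_pd_pd hx] at h
  simp only [dotProduct_comm (A *ᵥ _), P.form_tangent hA hQ hx] at h
  simp only [mul_neg, Finset.sum_neg_distrib, ← mul_assoc, ← Finset.sum_mul, smul_eq_mul] at h
  have e : ∀ l, metric f ξ x i l = metric f ξ x l i := P.metric_symm hx i
  simp only [cubicForm, e] at h ⊢
  linear_combination h

/-- Otherwise the gradient annihilates the whole frame, hence vanishes at a point of the quadric,
and the extended matrix is singular. -/
theorem gradient_normal_ne_zero (P : IsBlaschkePatch f ξ U) (hA : A.IsSymm)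
    (hQ : ∀ y ∈ U, f y ⬝ᵥ A *ᵥ f y + 2 * (b ⬝ᵥ f y) + d = 0)
    (hdet : (Matrix.fromBlocks A (Matrix.replicateCol Unit b) (Matrix.replicateRow Unit b)
      (Matrix.of fun _ _ : Unit => d)).det ≠ 0) (hx : x ∈ U) :
    (A *ᵥ f x + b) ⬝ᵥ ξ x ≠ 0 := by
  intro h
  refine hdet (det_extended_eq_zero A b d (f x) (dotProduct_eq_zero _ fun v => ?_) (hQ x hx))
  obtain ⟨w, t, rfl⟩ := P.exists_frame_coeff hx v
  simp [dotProduct_add _ (∑ k, _), dotProduct_sum, P.gradient_tangent hA hQ hx, h]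

/-- Trace `gradient_normal_mul_cubicForm` with the inverse metric: apolarity kills the left side,
and the right side is `-(n + 2)` times the quantity in question. -/
theorem form_tangent_normal (P : IsBlaschkePatch f ξ U) (hA : A.IsSymm)
    (hQ : ∀ y ∈ U, f y ⬝ᵥ A *ᵥ f y + 2 * (b ⬝ᵥ f y) + d = 0) (hx : x ∈ U) (k : Fin n) :
    ξ x ⬝ᵥ A *ᵥ pd k f x = 0 := by
  set a : Fin n → ℝ := fun k => ξ x ⬝ᵥ A *ᵥ pd k f x with ha
  have hs : ∑ i, ∑ j, (metric f ξ x)⁻¹ i j * (metric f ξ x j i * a k + metric f ξ x k j * a i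
      + metric f ξ x k i * a j) = 0 := by
    have := congrArg (fun t => -(((A *ᵥ f x + b) ⬝ᵥ ξ x) * t)) (P.apolarity hx k)
    simp only [mul_zero, neg_zero, Finset.mul_sum, ← Finset.sum_neg_distrib] at this
    rw [← this]
    refine Finset.sum_congr rfl fun i _ => Finset.sum_congr rfl fun j _ => ?_
    linear_combination (metric f ξ x)⁻¹ i j * P.gradient_normal_mul_cubicForm hA hQ hx k j i
  have t1 : ∑ i, ∑ j, (metric f ξ x)⁻¹ i j * (metric f ξ x j i * a k) = n * a k := by
    simp only [← mul_assoc, ← Finset.sum_mul, P.inv_metric_mul hx]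
    simp
  have t2 : ∑ i, ∑ j, (metric f ξ x)⁻¹ i j * (metric f ξ x k j * a i) = a k := by
    simp only [P.metric_symm hx k, ← mul_assoc, ← Finset.sum_mul, P.inv_metric_mul hx]
    simp
  have t3 : ∑ i, ∑ j, (metric f ξ x)⁻¹ i j * (metric f ξ x k i * a j) = a k := by
    rw [Finset.sum_comm, ← t2]
    refine Finset.sum_congr rfl fun i _ => Finset.sum_congr rfl fun j _ => ?_
    rw [P.inv_metric_symm hx j i]
  simp only [mul_add, Finset.sum_add_distrib, t1, t2, t3] at hs
  have : ((n : ℝ) + 2) * a k = 0 := by linear_combination hs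
  exact (mul_eq_zero.1 this).resolve_left (by positivity)

theorem cubicForm_eq_zero_of_hyperquadric (P : IsBlaschkePatch f ξ U) (hA : A.IsSymm)
    (hQ : ∀ y ∈ U, f y ⬝ᵥ A *ᵥ f y + 2 * (b ⬝ᵥ f y) + d = 0)
    (hdet : (Matrix.fromBlocks A (Matrix.replicateCol Unit b) (Matrix.replicateRow Unit b)
      (Matrix.of fun _ _ : Unit => d)).det ≠ 0) (hx : x ∈ U) (i j k : Fin n) :
    cubicForm f ξ i j k x = 0 := by
  have h := P.gradient_normal_mul_cubicForm hA hQ hx i j k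
  simp only [P.form_tangent_normal hA hQ hx, mul_zero, add_zero, neg_zero] at h
  exact (mul_eq_zero.1 h).resolve_left (P.gradient_normal_ne_zero hA hQ hdet hx)

theorem pd_form_normal (P : IsBlaschkePatch f ξ U) (hA : A.IsSymm)
    (hQ : ∀ y ∈ U, f y ⬝ᵥ A *ᵥ f y + 2 * (b ⬝ᵥ f y) + d = 0) (hx : x ∈ U) (k : Fin n) :
    pd k (fun y => ξ y ⬝ᵥ A *ᵥ ξ y) x = 0 := by
  have hξ := P.diff hx P.smooth_normal
  rw [pd_dotProduct_const_mulVec A hξ hξ, dotProduct_mulVec_symm hA (ξ x),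
    dotProduct_comm (pd k ξ x), P.dotProduct_pd_normal hx]
  simp [dotProduct_comm (A *ᵥ ξ x), dotProduct_mulVec_symm hA _ (ξ x),
    P.form_tangent_normal hA hQ hx]

/-- Differentiating `ξᵀ A ∂_j f = 0` gives `φ W h = ψ h`, and `h` is invertible. -/
theorem weingarten_of_hyperquadric (P : IsBlaschkePatch f ξ U) (hA : A.IsSymm)
    (hQ : ∀ y ∈ U, f y ⬝ᵥ A *ᵥ f y + 2 * (b ⬝ᵥ f y) + d = 0)
    (hdet : (Matrix.fromBlocks A (Matrix.replicateCol Unit b) (Matrix.replicateRow Unit b)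
      (Matrix.of fun _ _ : Unit => d)).det ≠ 0) (hx : x ∈ U) (i k : Fin n) :
    weingarten f ξ i k x
      = (ξ x ⬝ᵥ A *ᵥ ξ x) / ((A *ᵥ f x + b) ⬝ᵥ ξ x) * if i = k then 1 else 0 := by
  have hφ := P.gradient_normal_ne_zero hA hQ hdet hx
  set φ := (A *ᵥ f x + b) ⬝ᵥ ξ x with hφd
  set ψ := ξ x ⬝ᵥ A *ᵥ ξ x with hψ
  have key : ∀ j, φ * ∑ l, weingarten f ξ i l x * metric f ξ x l j = ψ * metric f ξ x i j := by
    intro j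
    have h := pd_congr P.isOpen (g' := fun _ => (0 : ℝ))
      (fun y hy => P.form_tangent_normal hA hQ hy j) hx i
    rw [pd_const, pd_dotProduct_const_mulVec A (P.diff hx P.smooth_normal)
      (P.diff hx (contDiffOn_pd P.isOpen P.smooth j)), dotProduct_mulVec_symm hA (ξ x),
      dotProduct_comm, P.dotProduct_pd_normal hx, dotProduct_comm (pd i (pd j f) x),
      P.dotProduct_pd_pd hx] at h
    simp only [dotProduct_comm (A *ᵥ _), P.form_tangent hA hQ hx, ← hφd, ← hψ,
      dotProduct_mulVec_symm hA (pd _ f x) (ξ x), P.form_tangent_normal hA hQ hx, mul_zero,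
      Finset.sum_const_zero, zero_add, mul_neg, Finset.sum_neg_distrib, ← mul_assoc,
      ← Finset.sum_mul] at h
    linear_combination -h
  have hz := P.eq_zero_of_metric hx
    (w := fun l => φ * weingarten f ξ i l x - ψ * if i = l then 1 else 0) fun j => by
      simp only [sub_mul, Finset.sum_sub_distrib, mul_assoc, ← Finset.mul_sum, key]
      simp
  have := congrFun hz k
  simp only [Pi.zero_apply] at this
  rw [div_mul_eq_mul_div, eq_div_iff hφ]
  linarith

theorem curvature_of_hyperquadric (P : IsBlaschkePatch f ξ U) (hA : A.IsSymm)
    (hQ : ∀ y ∈ U, f y ⬝ᵥ A *ᵥ f y + 2 * (b ⬝ᵥ f y) + d = 0)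
    (hdet : (Matrix.fromBlocks A (Matrix.replicateCol Unit b) (Matrix.replicateRow Unit b)
      (Matrix.of fun _ _ : Unit => d)).det ≠ 0) (hx : x ∈ U) (i j k l : Fin n) :
    curvature f ξ i j k l x = -((ξ x ⬝ᵥ A *ᵥ ξ x) / ((A *ᵥ f x + b) ⬝ᵥ ξ x))
      * (metric f ξ x j k * (if i = l then 1 else 0)
        - metric f ξ x i k * (if j = l then 1 else 0)) := by
  rw [P.curvature_eq_of_cubicForm_eq_zero (fun y hy i j k =>
      P.cubicForm_eq_zero_of_hyperquadric hA hQ hdet hy i j k) hx,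
    P.weingarten_of_hyperquadric hA hQ hdet hx, P.weingarten_of_hyperquadric hA hQ hdet hx]
  ring

end

theorem sectionalCurvature_eq (P : IsBlaschkePatch f ξ U) (hx : x ∈ U) {κ : ℝ}
    (hR : ∀ i j k l, curvature f ξ i j k l x = κ * (metric f ξ x j k * (if i = l then 1 else 0)
      - metric f ξ x i k * (if j = l then 1 else 0))) {u v : Fin n → ℝ}
    (h : areaForm f ξ x u v ≠ 0) : sectionalCurvature f ξ x u v = κ := by
  have e : curvatureApply f ξ x u v v
      = (κ * metricApply f ξ x v v) • u + (-(κ * metricApply f ξ x u v)) • v := by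
    ext l
    simp only [curvatureApply, hR, metricApply_eq_sum, Pi.add_apply, Pi.smul_apply, smul_eq_mul,
      mul_sub, Finset.sum_sub_distrib, neg_mul, ← sub_eq_add_neg]
    congr 1
    · simp only [mul_ite, mul_one, mul_zero]
      rw [Finset.sum_eq_single l (fun i _ hi => by simp [hi]) (by simp)]
      simp only [if_true, Finset.mul_sum, Finset.sum_mul]
      exact Finset.sum_congr rfl fun _ _ => Finset.sum_congr rfl fun _ _ => by ring
    · rw [Finset.mul_sum, Finset.sum_mul]
      refine Finset.sum_congr rfl fun i _ => ?_
      simp only [mul_ite, mul_one, mul_zero]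
      rw [Finset.sum_eq_single l (fun i _ hi => by simp [hi]) (by simp)]
      simp only [if_true, Finset.mul_sum, Finset.sum_mul]
      exact Finset.sum_congr rfl fun _ _ => by ring
  rw [sectionalCurvature, div_eq_iff h, e, metricApply_add_left, metricApply_smul_left,
    metricApply_smul_left, areaForm, P.metricApply_symm hx v u]
  ring

/-- In constant curvature `κ` with vanishing cubic form, the shape operator is `κ`. -/
theorem pd_normal_of_constantCurvature (P : IsBlaschkePatch f ξ U) (hn : 2 ≤ n) {κ : ℝ}
    (hC : ∀ y ∈ U, ∀ i j k, cubicForm f ξ i j k y = 0) (hx : x ∈ U)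
    (hR : ∀ i j k l, curvature f ξ i j k l x = κ * (metric f ξ x j k * (if i = l then 1 else 0)
      - metric f ξ x i k * (if j = l then 1 else 0))) (j : Fin n) :
    pd j ξ x = -κ • pd j f x := by
  have key : ∀ l, weingarten f ξ j l x = -κ * if j = l then 1 else 0 := by
    intro l
    set T : Fin n → ℝ := fun j => weingarten f ξ j l x + κ * if j = l then 1 else 0 with hT
    have h : ∀ i k, metric f ξ x i k * T j - metric f ξ x j k * T i = 0 := by
      intro i k
      have := hR i j k l
      rw [P.curvature_eq_of_cubicForm_eq_zero hC hx] at this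
      simp only [hT]
      linear_combination this
    -- The trace of the Gauss equation is `(n - 1) T_j = 0`; this is where `n ≥ 2` enters.
    have hs : ∑ k, ∑ i, (metric f ξ x)⁻¹ k i * (metric f ξ x i k * T j - metric f ξ x j k * T i)
        = 0 := Finset.sum_eq_zero fun k _ => Finset.sum_eq_zero fun i _ => by rw [h, mul_zero]
    have t1 : ∑ k, ∑ i, (metric f ξ x)⁻¹ k i * (metric f ξ x i k * T j) = n * T j := by
      simp only [← mul_assoc, ← Finset.sum_mul, P.inv_metric_mul hx]
      simp
    have t2 : ∑ k, ∑ i, (metric f ξ x)⁻¹ k i * (metric f ξ x j k * T i) = T j := by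
      rw [Finset.sum_comm]
      have : ∀ i k, (metric f ξ x)⁻¹ k i * (metric f ξ x j k * T i)
          = metric f ξ x j k * (metric f ξ x)⁻¹ k i * T i := fun i k => by ring
      simp only [this, ← Finset.sum_mul, P.metric_mul_inv hx]
      simp
    simp only [mul_sub, Finset.sum_sub_distrib, t1, t2] at hs
    have hn' : (n : ℝ) - 1 ≠ 0 := by
      have : (2 : ℝ) ≤ n := by exact_mod_cast hn
      linarith
    have : ((n : ℝ) - 1) * T j = 0 := by linear_combination hs
    have := (mul_eq_zero.1 this).resolve_left hn'
    simp only [hT] at this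
    linarith
  rw [P.pd_normal hx]
  simp [key]

theorem eq_zero_of_frame (P : IsBlaschkePatch f ξ U) (hx : x ∈ U)
    {D : Matrix (Fin (n + 1)) (Fin (n + 1)) ℝ} (h1 : ∀ i j, pd i f x ⬝ᵥ D *ᵥ pd j f x = 0)
    (h2 : ∀ i, pd i f x ⬝ᵥ D *ᵥ ξ x = 0) (h3 : ∀ i, ξ x ⬝ᵥ D *ᵥ pd i f x = 0)
    (h4 : ξ x ⬝ᵥ D *ᵥ ξ x = 0) : D = 0 := by
  have h : ∀ u v, u ⬝ᵥ D *ᵥ v = 0 := by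
    intro u v
    obtain ⟨w, t, rfl⟩ := P.exists_frame_coeff hx u
    obtain ⟨w', t', rfl⟩ := P.exists_frame_coeff hx v
    simp [Matrix.mulVec_add, Matrix.mulVec_smul, Matrix.mulVec_sum, dotProduct_add, add_dotProduct,
      dotProduct_sum, sum_dotProduct, h1, h2, h3, h4]
  ext r s
  simpa using h (Pi.single r 1) (Pi.single s 1)

/-- A hyperquadric centered at the origin is determined by an open part. -/
theorem eq_zero_of_form_normal_eq_zero (P : IsBlaschkePatch f ξ U) {κ : ℝ} (hκ : κ ≠ 0)
    (hξ : ∀ y ∈ U, ∀ j, pd j ξ y = -κ • pd j f y)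
    {D : Matrix (Fin (n + 1)) (Fin (n + 1)) ℝ} (hD : D.IsSymm)
    (h : ∀ y ∈ U, ξ y ⬝ᵥ D *ᵥ ξ y = 0) (hx : x ∈ U) : D = 0 := by
  -- As `∂_i ξ = -κ ∂_i f` with `κ ≠ 0`, one derivative of `ξᵀ D ξ = 0` gives the mixed entries of
  -- `D` in the frame, a second one the tangential entries.
  have h1 : ∀ y ∈ U, ∀ i, ξ y ⬝ᵥ D *ᵥ pd i f y = 0 := by
    intro y hy i
    have hd := P.diff hy P.smooth_normal
    have e := pd_congr P.isOpen (g' := fun _ => (0 : ℝ)) (fun y hy => h y hy) hy i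
    rw [pd_const, pd_dotProduct_const_mulVec D hd hd, dotProduct_mulVec_symm hD (pd i ξ y),
      hξ y hy, Matrix.mulVec_smul, dotProduct_smul, smul_eq_mul] at e
    refine (mul_eq_zero.1 (?_ : (-κ) * _ = 0)).resolve_left (neg_ne_zero.2 hκ)
    linarith
  refine P.eq_zero_of_frame hx (fun i j => ?_) (fun i => ?_) (h1 x hx) (h x hx)
  · have e := pd_congr P.isOpen (g' := fun _ => (0 : ℝ)) (fun y hy => h1 y hy j) hx i
    rw [pd_const, pd_dotProduct_const_mulVec D (P.diff hx P.smooth_normal)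
      (P.diff hx (contDiffOn_pd P.isOpen P.smooth j)), hξ x hx, smul_dotProduct, smul_eq_mul,
      dotProduct_mulVec_symm hD (ξ x), dotProduct_comm (pd i (pd j f) x),
      P.dotProduct_pd_pd hx] at e
    simp only [dotProduct_comm (D *ᵥ ξ x), dotProduct_mulVec_symm hD _ (ξ x), h1 x hx, h x hx,
      mul_zero, Finset.sum_const_zero, add_zero] at e
    exact (mul_eq_zero.1 e).resolve_left (neg_ne_zero.2 hκ)
  · rw [dotProduct_mulVec_symm hD, h1 x hx]

end IsBlaschkePatch

end Hyperquadric

/-! ### From vanishing derivatives in charts to constants on a connected manifold -/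

section LocallyConstant

variable {n : ℕ} {V : Type*} [NormedAddCommGroup V] [NormedSpace ℝ V]
  {U : Set (EuclideanSpace ℝ (Fin n))} {x : EuclideanSpace ℝ (Fin n)}

theorem eventually_eq_of_pd_eq_zero {g : EuclideanSpace ℝ (Fin n) → V} (hU : IsOpen U)
    (hg : ∀ y ∈ U, DifferentiableAt ℝ g y) (h : ∀ y ∈ U, ∀ i, pd i g y = 0) (hx : x ∈ U) :
    ∀ᶠ y in nhds x, g y = g x := by
  obtain ⟨r, hr, hb⟩ := Metric.isOpen_iff.1 hU x hx
  filter_upwards [Metric.ball_mem_nhds x hr] with y hy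
  exact Metric.isOpen_ball.is_const_of_fderiv_eq_zero (convex_ball x r).isPreconnected
    (fun z hz => (hg z (hb hz)).differentiableWithinAt)
    (fun z hz => fderiv_eq_zero_of_pd (h z (hb hz))) hy (Metric.mem_ball_self hr)

variable {M : Type*} [TopologicalSpace M] [ChartedSpace (EuclideanSpace ℝ (Fin n)) M]

theorem eventually_nhds_of_chart {p : M → Prop} (q : M)
    (h : ∀ᶠ y in nhds (chartAt (EuclideanSpace ℝ (Fin n)) q q),
      p ((chartAt (EuclideanSpace ℝ (Fin n)) q).symm y)) : ∀ᶠ q' in nhds q, p q' := by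
  set e := chartAt (EuclideanSpace ℝ (Fin n)) q with he
  have hq : q ∈ e.source := mem_chart_source _ q
  filter_upwards [(e.continuousAt hq).eventually h, e.open_source.mem_nhds hq] with q' h1 h2
  rwa [e.left_inv h2] at h1

theorem eq_of_pd_eq_zero [PreconnectedSpace M] {g : M → V}
    (hg : ∀ e ∈ atlas (EuclideanSpace ℝ (Fin n)) M, ∀ x ∈ e.target,
      DifferentiableAt ℝ (g ∘ e.symm) x)
    (h : ∀ e ∈ atlas (EuclideanSpace ℝ (Fin n)) M, ∀ x ∈ e.target, ∀ i,
      pd i (g ∘ e.symm) x = 0) (p q : M) : g p = g q := by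
  refine IsLocallyConstant.apply_eq_of_preconnectedSpace
    ((IsLocallyConstant.iff_eventually_eq g).2 fun q => ?_) p q
  have ha := chart_mem_atlas (EuclideanSpace ℝ (Fin n)) q
  refine eventually_nhds_of_chart (n := n) q ?_
  have := eventually_eq_of_pd_eq_zero (chartAt (EuclideanSpace ℝ (Fin n)) q).open_target
    (hg _ ha) (h _ ha) (mem_chart_target _ q)
  simpa using this

end LocallyConstant

/-! ### The parallel ambient form and the local quadric -/

section LocalQuadric

variable {n : ℕ} {f ξ : EuclideanSpace ℝ (Fin n) → Fin (n + 1) → ℝ}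
  {U : Set (EuclideanSpace ℝ (Fin n))} {x : EuclideanSpace ℝ (Fin n)}

/-- The matrix of the bilinear form on `ℝ^(n+1)` that restricts to the affine metric on the
tangent space and for which `ξ` is orthogonal to it with `(ξ, ξ) = κ`. -/
noncomputable def ambientForm (f ξ : EuclideanSpace ℝ (Fin n) → Fin (n + 1) → ℝ) (κ : ℝ)
    (x : EuclideanSpace ℝ (Fin n)) : Matrix (Fin (n + 1)) (Fin (n + 1)) ℝ :=
  ((frame f ξ x)⁻¹)ᵀ * (Matrix.of (Fin.snoc (α := fun _ => Fin (n + 1) → ℝ)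
    (fun i => Fin.snoc (α := fun _ => ℝ) (metric f ξ x i) 0)
    (Fin.snoc (α := fun _ => ℝ) 0 κ))) * (frame f ξ x)⁻¹

namespace IsBlaschkePatch

theorem smooth_ambientForm (P : IsBlaschkePatch f ξ U) (κ : ℝ) (r s : Fin (n + 1)) :
    ContDiffOn ℝ ∞ (fun y => ambientForm f ξ κ y r s) U := by
  have hi := contDiffOn_inv P.smooth_frame P.det_frame
  simp only [ambientForm, Matrix.mul_apply, Matrix.transpose_apply]
  refine ContDiffOn.sum fun c _ => (ContDiffOn.sum fun c' _ => (hi c' r).mul ?_).mul (hi c s)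
  refine Fin.lastCases ?_ (fun i => ?_) c' <;> refine Fin.lastCases ?_ (fun j => ?_) c
  · simpa using contDiffOn_const
  · simpa using contDiffOn_const
  · simpa using contDiffOn_const
  · simpa using P.smooth_metric i j

theorem ambientForm_apply (P : IsBlaschkePatch f ξ U) (hx : x ∈ U) (κ : ℝ)
    (w w' : Fin (n + 1) → ℝ) :
    (frame f ξ x *ᵥ w) ⬝ᵥ ambientForm f ξ κ x *ᵥ (frame f ξ x *ᵥ w')
      = ∑ i : Fin n, ∑ j : Fin n, w i.castSucc * w' j.castSucc * metric f ξ x i j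
        + κ * w (Fin.last n) * w' (Fin.last n) := by
  have hu := (P.det_frame x hx).isUnit
  rw [ambientForm, Matrix.mulVec_mulVec, Matrix.mul_assoc, Matrix.nonsing_inv_mul _ hu,
    Matrix.mul_one, ← Matrix.mulVec_mulVec, Matrix.dotProduct_mulVec, Matrix.vecMul_transpose,
    Matrix.mulVec_mulVec, Matrix.nonsing_inv_mul _ hu, Matrix.one_mulVec]
  simp only [dotProduct, Matrix.mulVec, Fin.sum_univ_castSucc, Matrix.of_apply, Fin.snoc_castSucc,
    Fin.snoc_last, zero_mul, add_zero, Pi.zero_apply, Finset.sum_const_zero, zero_add,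
    Finset.mul_sum]
  congr 1
  · exact Finset.sum_congr rfl fun _ _ => Finset.sum_congr rfl fun _ _ => by ring
  · ring

theorem frame_mulVec_castSucc (i : Fin n) :
    frame f ξ x *ᵥ Pi.single i.castSucc 1 = pd i f x := by
  ext r; simp [frame]

theorem frame_mulVec_last : frame f ξ x *ᵥ Pi.single (Fin.last n) 1 = ξ x := by
  ext r; simp [frame]

theorem ambientForm_tangent (P : IsBlaschkePatch f ξ U) (hx : x ∈ U) (κ : ℝ) (i j : Fin n) :
    pd i f x ⬝ᵥ ambientForm f ξ κ x *ᵥ pd j f x = metric f ξ x i j := by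
  rw [← frame_mulVec_castSucc (ξ := ξ) i, ← frame_mulVec_castSucc (ξ := ξ) j,
    P.ambientForm_apply hx]
  simp [Pi.single_apply]

theorem ambientForm_tangent_normal (P : IsBlaschkePatch f ξ U) (hx : x ∈ U) (κ : ℝ) (i : Fin n) :
    pd i f x ⬝ᵥ ambientForm f ξ κ x *ᵥ ξ x = 0 := by
  conv_lhs => rw [← frame_mulVec_castSucc (ξ := ξ) i]
  conv_lhs => enter [2, 2]; rw [← frame_mulVec_last (f := f) (ξ := ξ)]
  rw [P.ambientForm_apply hx]
  simp [Pi.single_apply]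

theorem ambientForm_normal (P : IsBlaschkePatch f ξ U) (hx : x ∈ U) (κ : ℝ) :
    ξ x ⬝ᵥ ambientForm f ξ κ x *ᵥ ξ x = κ := by
  have := P.ambientForm_apply hx κ (Pi.single (Fin.last n) 1) (Pi.single (Fin.last n) 1)
  rw [frame_mulVec_last] at this
  rw [this]
  simp

theorem ambientForm_isSymm (P : IsBlaschkePatch f ξ U) (hx : x ∈ U) (κ : ℝ) :
    (ambientForm f ξ κ x).IsSymm := by
  have hs : ∀ u v, u ⬝ᵥ ambientForm f ξ κ x *ᵥ v = v ⬝ᵥ ambientForm f ξ κ x *ᵥ u := by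
    intro u v
    rw [← P.frame_mulVec_inv hx u, ← P.frame_mulVec_inv hx v, P.ambientForm_apply hx,
      P.ambientForm_apply hx, Finset.sum_comm]
    congr 1
    · refine Finset.sum_congr rfl fun i _ => Finset.sum_congr rfl fun j _ => ?_
      rw [P.metric_symm hx j i]; ring
    · ring
  ext r s
  simpa using hs (Pi.single s 1) (Pi.single r 1)

/-- In the frame the form is block diagonal with blocks `h` and `κ`, both non-degenerate. -/
theorem det_ambientForm_ne_zero (P : IsBlaschkePatch f ξ U) (hx : x ∈ U) {κ : ℝ} (hκ : κ ≠ 0) :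
    (ambientForm f ξ κ x).det ≠ 0 := by
  intro h
  obtain ⟨v, hv, h0⟩ := Matrix.exists_mulVec_eq_zero_iff.2 h
  obtain ⟨w, t, rfl⟩ := P.exists_frame_coeff hx v
  have hs := dotProduct_mulVec_symm (P.ambientForm_isSymm hx κ)
  have h1 : ∀ i, ∑ k, w k * metric f ξ x k i = 0 := by
    intro i
    have : pd i f x ⬝ᵥ ambientForm f ξ κ x *ᵥ (∑ k, w k • pd k f x + t • ξ x) = 0 := by
      rw [h0]; simp
    simpa [Matrix.mulVec_add, Matrix.mulVec_smul, Matrix.mulVec_sum, dotProduct_add,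
      dotProduct_sum, P.ambientForm_tangent hx, P.ambientForm_tangent_normal hx,
      P.metric_symm hx i] using this
  have h2 : κ * t = 0 := by
    have : ξ x ⬝ᵥ ambientForm f ξ κ x *ᵥ (∑ k, w k • pd k f x + t • ξ x) = 0 := by
      rw [h0]; simp
    simp only [Matrix.mulVec_add, Matrix.mulVec_smul, Matrix.mulVec_sum, dotProduct_add,
      dotProduct_sum, dotProduct_smul, P.ambientForm_normal hx, hs (ξ x) (pd _ f x),
      P.ambientForm_tangent_normal hx, smul_eq_mul, mul_zero, Finset.sum_const_zero] at this
    linarith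
  have hw := P.eq_zero_of_metric hx h1
  have ht := (mul_eq_zero.1 h2).resolve_left hκ
  exact hv (by simp [hw, ht])

/-- Differentiate the values of the form on the frame. On tangent pairs its derivative is `C = 0`;
on mixed pairs the contributions `κ h_ai` and `-κ h_ia` cancel, which is why `ξ` is given square
`κ`. -/
theorem pd_ambientForm (P : IsBlaschkePatch f ξ U) {κ : ℝ}
    (hξ : ∀ y ∈ U, ∀ j, pd j ξ y = -κ • pd j f y)
    (hC : ∀ y ∈ U, ∀ i j k, cubicForm f ξ i j k y = 0) (hx : x ∈ U) (a : Fin n)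
    (r s : Fin (n + 1)) : pd a (fun y => ambientForm f ξ κ y r s) x = 0 := by
  have hA := fun r s => P.diff hx (P.smooth_ambientForm κ r s)
  have hf := fun i => P.diff hx (contDiffOn_pd P.isOpen P.smooth i)
  have hn := P.diff hx P.smooth_normal
  have hs : ∀ y ∈ U, ∀ u v, u ⬝ᵥ ambientForm f ξ κ y *ᵥ v = v ⬝ᵥ ambientForm f ξ κ y *ᵥ u :=
    fun y hy => dotProduct_mulVec_symm (P.ambientForm_isSymm hy κ)
  have key : (Matrix.of fun r s => pd a (fun y => ambientForm f ξ κ y r s) x) = 0 := by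
    have t1 : ∀ i, pd i f x ⬝ᵥ (Matrix.of fun r s => pd a (fun y => ambientForm f ξ κ y r s) x)
        *ᵥ ξ x = 0 := by
      intro i
      have e := pd_congr P.isOpen (g' := fun _ => (0 : ℝ))
        (fun y hy => P.ambientForm_tangent_normal hy κ i) hx a
      rw [pd_const, pd_dotProduct_mulVec hA (hf i) hn, hξ x hx, dotProduct_comm (pd a (pd i f) x),
        P.dotProduct_pd_pd hx] at e
      simp only [dotProduct_comm (ambientForm f ξ κ x *ᵥ ξ x), P.ambientForm_tangent_normal hx,
        P.ambientForm_normal hx, Matrix.mulVec_smul, dotProduct_smul, P.ambientForm_tangent hx,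
        mul_zero, Finset.sum_const_zero, smul_eq_mul, P.metric_symm hx i a] at e
      linarith
    refine P.eq_zero_of_frame hx (fun i j => ?_) t1 (fun i => ?_) ?_
    · have e := pd_congr P.isOpen (fun y hy => P.ambientForm_tangent hy κ i j) hx a
      rw [pd_dotProduct_mulVec hA (hf i) (hf j), dotProduct_comm (pd a (pd i f) x),
        hs x hx _ (pd a (pd j f) x), dotProduct_comm (pd a (pd j f) x), P.dotProduct_pd_pd hx,
        P.dotProduct_pd_pd hx] at e
      simp only [dotProduct_comm (ambientForm f ξ κ x *ᵥ _), P.ambientForm_tangent hx,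
        hs x hx (ξ x) (pd _ f x), P.ambientForm_tangent_normal hx, mul_zero, add_zero] at e
      have c := hC x hx a i j
      rw [cubicForm] at c
      have m : ∀ l, metric f ξ x i l = metric f ξ x l i := P.metric_symm hx i
      simp only [m] at c e
      linarith
    · rw [dotProduct_mulVec_symm _ (ξ x), t1]
      ext r s
      exact pd_congr P.isOpen (fun y hy => (P.ambientForm_isSymm hy κ).apply r s) hx a
    · have e := pd_congr P.isOpen (g' := fun _ => κ) (fun y hy => P.ambientForm_normal hy κ) hx a
      rw [pd_const, pd_dotProduct_mulVec hA hn hn, hξ x hx] at e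
      simpa [Matrix.mulVec_neg, Matrix.mulVec_smul, hs x hx (ξ x) (pd _ f x), P.ambientForm_tangent_normal hx] using e
  exact congrFun (congrFun key r) s

/-- If the cubic form vanishes and the shape operator is `κ ≠ 0`, then locally `ξ` takes values in
a hyperquadric centered at the origin. -/
theorem exists_form_normal_eq (P : IsBlaschkePatch f ξ U) {κ : ℝ} (hκ : κ ≠ 0)
    (hξ : ∀ y ∈ U, ∀ j, pd j ξ y = -κ • pd j f y)
    (hC : ∀ y ∈ U, ∀ i j k, cubicForm f ξ i j k y = 0) (hx : x ∈ U) :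
    ∃ A : Matrix (Fin (n + 1)) (Fin (n + 1)) ℝ, A.IsSymm ∧ A.det ≠ 0 ∧
      ∀ᶠ y in nhds x, ξ y ⬝ᵥ A *ᵥ ξ y = κ := by
  refine ⟨ambientForm f ξ κ x, P.ambientForm_isSymm hx κ, P.det_ambientForm_ne_zero hx hκ, ?_⟩
  have h : ∀ᶠ y in nhds x, ∀ r s, ambientForm f ξ κ y r s = ambientForm f ξ κ x r s := by
    simp only [Filter.eventually_all]
    exact fun r s => eventually_eq_of_pd_eq_zero P.isOpen
      (fun y hy => P.diff hy (P.smooth_ambientForm κ r s))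
      (fun y hy i => P.pd_ambientForm hξ hC hy i r s) hx
  filter_upwards [h, P.isOpen.mem_nhds hx] with y hy hyU
  have : ambientForm f ξ κ x = ambientForm f ξ κ y := by ext r s; exact (hy r s).symm
  rw [this, P.ambientForm_normal hyU]

end IsBlaschkePatch

end LocalQuadric

/-! ### Charts as Blaschke patches -/

section Charts

variable {n : ℕ} {M : Type*} [TopologicalSpace M] [ChartedSpace (EuclideanSpace ℝ (Fin n)) M]
  {F ξ : M → Fin (n + 1) → ℝ}

theorem contDiffOn_comp_symm [IsManifold (𝓡 n) ∞ M] {V : Type*} [NormedAddCommGroup V]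
    [NormedSpace ℝ V] {g : M → V} (hg : ContMDiff (𝓡 n) 𝓘(ℝ, V) ∞ g)
    {e : OpenPartialHomeomorph M (EuclideanSpace ℝ (Fin n))}
    (he : e ∈ atlas (EuclideanSpace ℝ (Fin n)) M) : ContDiffOn ℝ ∞ (g ∘ e.symm) e.target :=
  contMDiffOn_iff_contDiffOn.1 (hg.comp_contMDiffOn
    (contMDiffOn_symm_of_mem_maximalAtlas (IsManifold.subset_maximalAtlas he)))

theorem isBlaschkePatch [IsManifold (𝓡 n) ∞ M] (hF : IsNondegenerateImmersion F)
    (hξ : IsAffineNormal F ξ) {e : OpenPartialHomeomorph M (EuclideanSpace ℝ (Fin n))}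
    (he : e ∈ atlas (EuclideanSpace ℝ (Fin n)) M) :
    IsBlaschkePatch (F ∘ e.symm) (ξ ∘ e.symm) e.target := by
  have hdet : ∀ x ∈ e.target, (frame (F ∘ e.symm) (ξ ∘ e.symm) x).det ≠ 0 := by
    intro x hx
    have hcol : (frame (F ∘ e.symm) (ξ ∘ e.symm) x).col
        = Fin.snoc (α := fun _ => Fin (n + 1) → ℝ) (fun k => pd k (F ∘ e.symm) x)
          ((ξ ∘ e.symm) x) := rfl
    have hli : LinearIndependent ℝ (frame (F ∘ e.symm) (ξ ∘ e.symm) x).col := by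
      rw [hcol]
      exact linearIndependent_finSnoc.2 ⟨hF.immersion e he x hx, hξ.transversal e he x hx⟩
    exact ((Matrix.isUnit_iff_isUnit_det _).1
      (Matrix.linearIndependent_cols_iff_isUnit.1 hli)).ne_zero
  refine ⟨e.open_target, contDiffOn_comp_symm hF.smooth he, contDiffOn_comp_symm hξ.smooth he,
    hdet, fun x hx i => ?_, fun x hx h => hF.nondegenerate e he x hx ?_, fun x hx => ?_⟩
  · obtain ⟨c, hc⟩ := (Submodule.mem_span_range_iff_exists_fun ℝ).1 (hξ.tangent e he x hx i)
    have : pd i (ξ ∘ e.symm) x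
        = frame (F ∘ e.symm) (ξ ∘ e.symm) x *ᵥ Fin.snoc (α := fun _ => ℝ) c 0 := by
      rw [frame_mulVec, ← hc]; simp
    rw [this, Matrix.mulVec_mulVec, Matrix.nonsing_inv_mul _ (hdet x hx).isUnit, Matrix.one_mulVec]
    simp
  -- By Cramer's rule the determinants `L_ij` are `det (frame)` times the `ξ`-coordinates of the
  -- second derivatives, so non-degeneracy of `L` passes to `h`.
  · have : secondFundamentalMatrix (F ∘ e.symm) x
        = (frame (F ∘ e.symm) (ξ ∘ e.symm) x).det • metric (F ∘ e.symm) (ξ ∘ e.symm) x := by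
      ext i j
      have hu : frame (F ∘ e.symm) (pd i (pd j (F ∘ e.symm))) x
          = (frame (F ∘ e.symm) (ξ ∘ e.symm) x).updateCol (Fin.last n)
            (pd i (pd j (F ∘ e.symm)) x) := by
        ext r c
        refine Fin.lastCases ?_ (fun k => ?_) c
        · simp [frame]
        · rw [Matrix.updateCol_ne (Fin.castSucc_lt_last k).ne]; simp [frame]
      simp only [secondFundamentalMatrix, Matrix.of_apply, hu]
      rw [← Matrix.cramer_apply, ← Matrix.det_smul_inv_mulVec_eq_cramer _ _ (hdet x hx).isUnit]
      rfl
    rw [this, Matrix.det_smul, h, mul_zero]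
  · have h := congrArg (· ^ 2) (hξ.volume e he x hx)
    simp only [sq_abs, Real.sq_sqrt (abs_nonneg _)] at h
    rw [← sq_abs (metric _ _ x).det, ← h]; ring

end Charts

/-! ### Globalization and the two implications -/

section Global

variable {n : ℕ} {M : Type*} [TopologicalSpace M] [ChartedSpace (EuclideanSpace ℝ (Fin n)) M]
  [IsManifold (𝓡 n) ∞ M] {F ξ : M → Fin (n + 1) → ℝ}

theorem semiParallel_of_cubicForm_eq_zero (hF : IsNondegenerateImmersion F)
    (hξ : IsAffineNormal F ξ)
    (hC : ∀ e ∈ atlas (EuclideanSpace ℝ (Fin n)) M, ∀ x ∈ e.target, ∀ i j k,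
      cubicForm (F ∘ e.symm) (ξ ∘ e.symm) i j k x = 0) : HasSemiParallelCubicForm F ξ := by
  intro e he x hx i j a b c
  rw [(isBlaschkePatch hF hξ he).curvatureDotCubic_eq hx]
  simp [hC e he x hx]

theorem semiParallel_of_flat (hF : IsNondegenerateImmersion F) (hξ : IsAffineNormal F ξ)
    (h : HasFlatAffineMetric F ξ) : HasSemiParallelCubicForm F ξ := by
  intro e he x hx i j a b c
  rw [(isBlaschkePatch hF hξ he).curvatureDotCubic_eq hx]
  simp [h e he x hx]

theorem constantCurvature_of_flat (hF : IsNondegenerateImmersion F) (hξ : IsAffineNormal F ξ)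
    (h : HasFlatAffineMetric F ξ) : HasConstantSectionalCurvature F ξ :=
  ⟨0, fun e he x hx _ _ hA => (isBlaschkePatch hF hξ he).sectionalCurvature_eq hx
    (fun i j k l => by rw [h e he x hx, zero_mul]) hA⟩

theorem semiParallel_and_constantCurvature_of_hyperquadric [ConnectedSpace M]
    (hF : IsNondegenerateImmersion F) (hξ : IsAffineNormal F ξ) (h : IsHyperquadric F) :
    HasSemiParallelCubicForm F ξ ∧ HasConstantSectionalCurvature F ξ := by
  obtain ⟨_, ⟨A, b, d, hA, hdet, rfl⟩, hQ⟩ := h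
  have hq : ∀ e : OpenPartialHomeomorph M (EuclideanSpace ℝ (Fin n)), ∀ y ∈ e.target,
      (F ∘ e.symm) y ⬝ᵥ A *ᵥ (F ∘ e.symm) y + 2 * (b ⬝ᵥ (F ∘ e.symm) y) + d = 0 :=
    fun e y _ => hQ ⟨e.symm y, rfl⟩
  refine ⟨semiParallel_of_cubicForm_eq_zero hF hξ fun e he x hx =>
    (isBlaschkePatch hF hξ he).cubicForm_eq_zero_of_hyperquadric hA (hq e) hdet hx, ?_⟩
  -- The curvature of each chart is `-ψ/φ`; constancy of `φ` and `ψ` on the connected manifold makes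
  -- it one number for all charts.
  have hφ := eq_of_pd_eq_zero (n := n) (g := fun p => (A *ᵥ F p + b) ⬝ᵥ ξ p)
    (fun e he x hx => differentiableAt_dotProduct
      ((isBlaschkePatch hF hξ he).differentiableAt_gradient hx)
      ((isBlaschkePatch hF hξ he).diff hx (isBlaschkePatch hF hξ he).smooth_normal))
    (fun e he x hx i => ((isBlaschkePatch hF hξ he).pd_gradient_normal hA (hq e) hx i).trans
      ((isBlaschkePatch hF hξ he).form_tangent_normal hA (hq e) hx i))
  have hψ := eq_of_pd_eq_zero (n := n) (g := fun p => ξ p ⬝ᵥ A *ᵥ ξ p)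
    (fun e he x hx => by
      have hd := (isBlaschkePatch hF hξ he).diff hx (isBlaschkePatch hF hξ he).smooth_normal
      exact differentiableAt_dotProduct hd
        (differentiableAt_mulVec (A := fun _ => A) (fun _ _ => differentiableAt_const _) hd))
    (fun e he x hx => (isBlaschkePatch hF hξ he).pd_form_normal hA (hq e) hx)
  obtain ⟨p⟩ : Nonempty M := inferInstance
  refine ⟨-((ξ p ⬝ᵥ A *ᵥ ξ p) / ((A *ᵥ F p + b) ⬝ᵥ ξ p)), fun e he x hx u v ha =>
    (isBlaschkePatch hF hξ he).sectionalCurvature_eq hx (fun i j k l => ?_) ha⟩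
  rw [(isBlaschkePatch hF hξ he).curvature_of_hyperquadric hA (hq e) hdet hx]
  have h1 : (A *ᵥ F p + b) ⬝ᵥ ξ p = (A *ᵥ (F ∘ e.symm) x + b) ⬝ᵥ (ξ ∘ e.symm) x :=
    hφ p (e.symm x)
  have h2 : ξ p ⬝ᵥ A *ᵥ ξ p = (ξ ∘ e.symm) x ⬝ᵥ A *ᵥ (ξ ∘ e.symm) x := hψ p (e.symm x)
  rw [h1, h2]

/-- If the cubic form vanishes and the shape operator is `κ ≠ 0`, then `ξ` takes values in a
hyperquadric centered at the origin. -/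
theorem exists_global_form [ConnectedSpace M] (hF : IsNondegenerateImmersion F)
    (hξ : IsAffineNormal F ξ) {κ : ℝ} (hκ : κ ≠ 0)
    (hC : ∀ e ∈ atlas (EuclideanSpace ℝ (Fin n)) M, ∀ x ∈ e.target, ∀ i j k,
      cubicForm (F ∘ e.symm) (ξ ∘ e.symm) i j k x = 0)
    (hS : ∀ e ∈ atlas (EuclideanSpace ℝ (Fin n)) M, ∀ x ∈ e.target, ∀ j,
      pd j (ξ ∘ e.symm) x = -κ • pd j (F ∘ e.symm) x) :
    ∃ A : Matrix (Fin (n + 1)) (Fin (n + 1)) ℝ, A.IsSymm ∧ A.det ≠ 0 ∧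
      ∀ p, ξ p ⬝ᵥ A *ᵥ ξ p = κ := by
  have hloc : ∀ p : M, ∃ A : Matrix (Fin (n + 1)) (Fin (n + 1)) ℝ, A.IsSymm ∧ A.det ≠ 0 ∧
      ∀ᶠ q in nhds p, ξ q ⬝ᵥ A *ᵥ ξ q = κ := by
    intro p
    have he := chart_mem_atlas (EuclideanSpace ℝ (Fin n)) p
    obtain ⟨A, h1, h2, h3⟩ := (isBlaschkePatch hF hξ he).exists_form_normal_eq hκ (hS _ he)
      (hC _ he) (mem_chart_target _ p)
    exact ⟨A, h1, h2, eventually_nhds_of_chart p h3⟩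
  -- The difference of two local forms vanishes on `ξ` over an open set, hence is zero. Therefore
  -- the chosen form `A p` is locally constant in `p`.
  have huniq : ∀ (p : M) (A A' : Matrix (Fin (n + 1)) (Fin (n + 1)) ℝ), A.IsSymm → A'.IsSymm →
      (∀ᶠ q in nhds p, ξ q ⬝ᵥ A *ᵥ ξ q = κ) → (∀ᶠ q in nhds p, ξ q ⬝ᵥ A' *ᵥ ξ q = κ) →
      A = A' := by
    intro p A A' hA hA' h h'
    set e := chartAt (EuclideanSpace ℝ (Fin n)) p with hed
    have he : e ∈ atlas (EuclideanSpace ℝ (Fin n)) M := chart_mem_atlas _ p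
    have hx : e p ∈ e.target := mem_chart_target _ p
    have hev : ∀ᶠ y in nhds (e p), ξ (e.symm y) ⬝ᵥ (A - A') *ᵥ ξ (e.symm y) = 0 := by
      have hc : Filter.Tendsto e.symm (nhds (e p)) (nhds p) := by
        have := e.continuousAt_symm hx
        rwa [ContinuousAt, e.left_inv (mem_chart_source _ p)] at this
      filter_upwards [hc.eventually h, hc.eventually h'] with y h1 h2
      rw [Matrix.sub_mulVec, dotProduct_sub, h1, h2, sub_self]
    obtain ⟨U, hU, hUo, hxU⟩ := eventually_nhds_iff.1 (hev.and (e.open_target.mem_nhds hx))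
    have P := (isBlaschkePatch hF hξ he).mono hUo fun y hy => (hU y hy).2
    exact sub_eq_zero.1 (P.eq_zero_of_form_normal_eq_zero hκ
      (fun y hy => hS e he y (hU y hy).2) (hA.sub hA') (fun y hy => (hU y hy).1) hxU)
  choose A hA hdet hev using hloc
  have hconst : ∀ p q, A p = A q := by
    refine IsLocallyConstant.apply_eq_of_preconnectedSpace
      ((IsLocallyConstant.iff_eventually_eq A).2 fun p => ?_)
    filter_upwards [(hev p).eventually_nhds] with q hq
    exact huniq q _ _ (hA q) (hA p) (hev q) hq
  obtain ⟨p⟩ : Nonempty M := inferInstance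
  refine ⟨A p, hA p, hdet p, fun q => ?_⟩
  rw [hconst p q]
  exact (hev q).self_of_nhds

/-- A nonsingular form `A` defines a non-degenerate hyperquadric with center `κ⁻¹ • v`. -/
theorem isNondegenerateHyperquadric_of_form {m : ℕ} {A : Matrix (Fin m) (Fin m) ℝ}
    (hA : A.IsSymm) (hdet : A.det ≠ 0) {κ : ℝ} (hκ : κ ≠ 0) (v : Fin m → ℝ) :
    IsNondegenerateHyperquadric {y | (v - κ • y) ⬝ᵥ A *ᵥ (v - κ • y) = κ} := by
  -- The coefficients of the expansion of `(v - κ y)ᵀ A (v - κ y) - κ`. A kernel vector `(y, t)` of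
  -- the extended matrix satisfies `κ y = t v` by the upper rows, and then the last row reduces to
  -- `-κ t = 0`.
  refine ⟨κ ^ 2 • A, -κ • (A *ᵥ v), v ⬝ᵥ A *ᵥ v - κ, hA.smul _, fun h => ?_, ?_⟩
  · obtain ⟨w, hw, h0⟩ := Matrix.exists_mulVec_eq_zero_iff.2 h
    rw [Matrix.fromBlocks_mulVec] at h0
    set y := w ∘ Sum.inl with hy
    set t := w (Sum.inr ()) with ht
    have h1 : A *ᵥ (κ • y - t • v) = 0 := by
      have : κ • (A *ᵥ (κ • y - t • v)) = 0 := by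
        ext r
        have := congrFun h0 (Sum.inl r)
        simp only [Sum.elim_inl, Pi.add_apply, Pi.zero_apply, Matrix.smul_mulVec, Pi.smul_apply,
          smul_eq_mul, Matrix.mulVec, dotProduct, Matrix.replicateCol, Matrix.of_apply,
          Finset.univ_unique, Finset.sum_singleton, Function.comp_apply] at this
        simp only [Matrix.mulVec_sub, Matrix.mulVec_smul, Pi.smul_apply, Pi.sub_apply, smul_eq_mul,
          Pi.zero_apply, Matrix.mulVec, dotProduct]
        linear_combination this
      exact (smul_eq_zero.1 this).resolve_left hκ
    have h2 : κ • y = t • v := by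
      have := Matrix.eq_zero_of_mulVec_eq_zero hdet h1
      exact sub_eq_zero.1 this
    have h3 : -κ * ((A *ᵥ v) ⬝ᵥ y) + (v ⬝ᵥ A *ᵥ v - κ) * t = 0 := by
      have : (-κ • (A *ᵥ v)) ⬝ᵥ y + (v ⬝ᵥ A *ᵥ v - κ) * t = 0 := by
        simpa [Matrix.mulVec, dotProduct, Matrix.replicateRow, ht] using congrFun h0 (Sum.inr ())
      rwa [smul_dotProduct, smul_eq_mul] at this
    have h4 : κ * ((A *ᵥ v) ⬝ᵥ y) = t * (v ⬝ᵥ A *ᵥ v) := by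
      rw [← smul_eq_mul, ← dotProduct_smul, h2, dotProduct_smul, smul_eq_mul, dotProduct_comm]
    have h5 : t = 0 := by
      have : κ * t = 0 := by linear_combination -h3 - h4
      exact (mul_eq_zero.1 this).resolve_left hκ
    have h6 : y = 0 := by
      rw [h5, zero_smul] at h2
      exact (smul_eq_zero.1 h2).resolve_left hκ
    refine hw (funext fun r => ?_)
    rcases r with r | r
    · exact congrFun h6 r
    · exact h5
  · ext y
    simp only [Set.mem_ofPred_eq, Matrix.mulVec_sub, Matrix.mulVec_smul, sub_dotProduct,
      dotProduct_sub, smul_dotProduct, dotProduct_smul, smul_eq_mul, Matrix.smul_mulVec,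
      dotProduct_comm (A *ᵥ v) y, dotProduct_mulVec_symm hA v y]
    constructor <;> intro h <;> linear_combination h

theorem isHyperquadric_or_flat [ConnectedSpace M] (hn : 2 ≤ n) (hF : IsNondegenerateImmersion F)
    (hξ : IsAffineNormal F ξ) (hC : HasSemiParallelCubicForm F ξ)
    (hK : HasConstantSectionalCurvature F ξ) : IsHyperquadric F ∨ HasFlatAffineMetric F ξ := by
  obtain ⟨κ, hκ⟩ := hK
  have hR := fun e he x hx => (isBlaschkePatch hF hξ (e := e) he).curvature_eq_of_sectionalCurvature_eq
    hn hx (hκ e he x hx)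
  by_cases h0 : κ = 0
  · right
    intro e he x hx i j k l
    rw [hR e he x hx, h0, zero_mul]
  left
  have hC0 : ∀ e ∈ atlas (EuclideanSpace ℝ (Fin n)) M, ∀ x ∈ e.target, ∀ i j k,
      cubicForm (F ∘ e.symm) (ξ ∘ e.symm) i j k x = 0 := fun e he x hx =>
    (isBlaschkePatch hF hξ he).cubicForm_eq_zero_of_semiParallel hx h0 (hR e he x hx)
      (hC e he x hx)
  have hS : ∀ e ∈ atlas (EuclideanSpace ℝ (Fin n)) M, ∀ x ∈ e.target, ∀ j,
      pd j (ξ ∘ e.symm) x = -κ • pd j (F ∘ e.symm) x := fun e he x hx =>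
    (isBlaschkePatch hF hξ he).pd_normal_of_constantCurvature hn (hC0 e he) hx (hR e he x hx)
  obtain ⟨A, hA, hdet, hform⟩ := exists_global_form hF hξ h0 hC0 hS
  have hd : ∀ e ∈ atlas (EuclideanSpace ℝ (Fin n)) M, ∀ x ∈ e.target,
      DifferentiableAt ℝ (ξ ∘ e.symm) x ∧ DifferentiableAt ℝ (fun y => κ • (F ∘ e.symm) y) x :=
    fun e he x hx => by
      have P := isBlaschkePatch hF hξ he
      exact ⟨P.diff hx P.smooth_normal, (P.diff hx P.smooth).fun_const_smul κ⟩
  -- The shape operator is `κ`, so `ξ + κ F` is a constant vector `v`. Substituting `ξ = v - κ F`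
  -- turns the quadric of `ξ` into one containing `F`, with center `κ⁻¹ v`.
  have hv := eq_of_pd_eq_zero (n := n) (g := fun p => ξ p + κ • F p)
    (fun e he x hx => (hd e he x hx).1.fun_add (hd e he x hx).2)
    (fun e he x hx i => by
      have P := isBlaschkePatch hF hξ he
      refine (pd_add (hd e he x hx).1 (hd e he x hx).2 i).trans ?_
      rw [pd_const_smul (P.diff hx P.smooth), hS e he x hx, neg_smul, neg_add_cancel])
  obtain ⟨p⟩ : Nonempty M := inferInstance
  refine ⟨_, isNondegenerateHyperquadric_of_form hA hdet h0 (ξ p + κ • F p), ?_⟩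
  rintro _ ⟨q, rfl⟩
  have : ξ p + κ • F p - κ • F q = ξ q := by rw [hv p q, add_sub_cancel_right]
  rw [Set.mem_ofPred_eq, this, hform]

end Global

end AffineHypersurface

theorem proposition3p1 {n : ℕ} (hn : 2 ≤ n) {M : Type*} [TopologicalSpace M] [ConnectedSpace M]
    [ChartedSpace (EuclideanSpace ℝ (Fin n)) M] [IsManifold (𝓡 n) ∞ M]
    (F ξ : M → Fin (n + 1) → ℝ)
    (hF : AffineHypersurface.IsNondegenerateImmersion F)
    (hξ : AffineHypersurface.IsAffineNormal F ξ) :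
    (AffineHypersurface.HasSemiParallelCubicForm F ξ ∧
        AffineHypersurface.HasConstantSectionalCurvature F ξ) ↔
      (AffineHypersurface.IsHyperquadric F ∨ AffineHypersurface.HasFlatAffineMetric F ξ) := by
  refine ⟨fun h => AffineHypersurface.isHyperquadric_or_flat hn hF hξ h.1 h.2, ?_⟩
  rintro (h | h)
  · exact AffineHypersurface.semiParallel_and_constantCurvature_of_hyperquadric hF hξ h
  · exact ⟨AffineHypersurface.semiParallel_of_flat hF hξ h,
      AffineHypersurface.constantCurvature_of_flat hF hξ h⟩
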